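/- Let $\mathbb{F}$ be an algebraically closed field of characteristic $0$, let $\Lambda(n)$ be the Grassmann superalgebra over $\mathbb{F}$ on odd generators $\xi_1,\dots,\xi_n$, put $\partial_i=\partial/\partial\xi_i$ and $x^u=\xi_{i_1}\cdots\xi_{i_k}$, $|u|=k$, for $u=(i_1<\dots<i_k)$. With the supercommutator as bracket, consider the following Lie superalgebras of superderivations of $\Lambda(n)$, together with subspaces $L_k$ and a Cartan subalgebra $\mathfrak h$ of $L_0$. * $W(n)=\operatorname{der}\Lambda(n)$, $n\ge 3$: $L_k=\operatorname{span}\{x^u\partial_i: |u|=k+1\}$, $\mathfrak h=\operatorname{span}\{\xi_i\partial_i\}$, $t=n-1$. * $S(n)=\bigoplus_{k=-1}^{n-2}L_k$, $n\ge 4$: $L_k=\operatorname{span}\{D_{ij}(x^u): |u|=k+2,\ 1\le i,j\le n\}$ with $D_{ij}(f)=\partial_i(f)\partial_j+\partial_j(f)\partial_i$, $\mathfrak h=\operatorname{span}\{\xi_i\partial_i-\xi_j\partial_j\}$, $t=n-2$. * $\widetilde S(2m)=\bigoplus_{k=-1}^{2m-2}L_k$, $m\ge 2$: $L_{-1}=\operatorname{span}\{(1+\xi_1\cdots\xi_{2m})\partial_j: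 1\le j\le 2m\}$, $L_k=S(2m)_k$ for $k\ge 0$, $\mathfrak h$ as for $S(2m)$, $t=1$. * $H(n)=\bigoplus_{k=-1}^{n-3}L_k$, $n\ge 5$: $L_k=\operatorname{span}\{D_H(x^u): |u|=k+2\}$ with $D_H(x^u)=(-1)^{|u|}\sum_i\partial_i(x^u)\partial_{i'}$, where, with $m=\lfloor n/2\rfloor$, $i\mapsto i'$ is the involution of $\{1,\dots,n\}$ exchanging $i$ and $i+m$ for $1\le i\le m$ and fixing $n$ if $n$ is odd; $\mathfrak h=\operatorname{span}\{\xi_i\partial_i-\xi_{i'}\partial_{i'}: 1\le i\le m\}$, $t=1$. For elements $a,b$ let $\langle a,b\rangle$ be the smallest linear subspace (not required to be $\mathbb{Z}_2$-graded) that contains $a$ and $b$ and is closed under the bracket. For a finite set $\Phi\subset\mathfrak h^*$ put $\Omega_\Phi=\{h\in\mathfrak h: f(h)\ne g(h)\text{ for all distinct } f,g\in\Phi\}$. Then every such $L$ is generated by $2$ elements. More precisely, let $r=2$ if $L=H(6)$ and $r=1$ otherwise. There are nonzero weight vectors (relative to $\mathfrak h$) $x_{-1}\in L_{-1}$ and $y_1,\dots,y_r\in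 L_t$, of pairwise distinct weights, an element $x_0\in L_0$, and a finite set $\Phi\subset\mathfrak h^*$ with $\Omega_\Phi\neq\emptyset$, such that for every $h\in\Omega_\Phi$ $$\langle x_0,h\rangle=L_0\qquad\text{and}\qquad \langle x_{-1}+x_0+y_1+\dots+y_r,\ h\rangle=L .$$ -/

import Mathlib

noncomputable section

namespace CartanSuper

/-- The Grassmann algebra `Λ(n)` over `F`. -/
abbrev Grassmann (F : Type*) [Field F] (n : ℕ) : Type _ := ExteriorAlgebra F (Fin n → F)

variable (F : Type*) [Field F] {n : ℕ}

/-- The even part (`p = 0`) and the odd part (`p = 1`) of `Λ(n)`. -/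
def part (n : ℕ) (p : ZMod 2) : Submodule F (Grassmann F n) :=
  CliffordAlgebra.evenOdd (0 : QuadraticForm F (Fin n → F)) p

/-- The generators `ξ_i` of `Λ(n)`. -/
def xi (i : Fin n) : Grassmann F n := ExteriorAlgebra.ι F (Pi.single i 1)

/-- `x^u = ξ_{i_1} ⋯ ξ_{i_k}` for a shuffle `u = (i_1 < ⋯ < i_k)`, given as a finite set. -/
def mono (u : Finset (Fin n)) : Grassmann F n := ((u.sort (· ≤ ·)).map (xi F)).prod

/-- The derivative `∂/∂ξ_i`: the left superderivation of `Λ(n)` with `ξ_j ↦ δ_{ij}`. -/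
def pd (i : Fin n) : Module.End F (Grassmann F n) :=
  CliffordAlgebra.contractLeft (Q := (0 : QuadraticForm F (Fin n → F))) (LinearMap.proj i)

/-- The operator `f ∂/∂ξ_i`. -/
def fpd (f : Grassmann F n) (i : Fin n) : Module.End F (Grassmann F n) :=
  LinearMap.mulLeft F f * pd F i

/-- The parity automorphism `a ↦ (-1)^p a` (for `a` of parity `p`) of `Λ(n)`. -/
def parity (n : ℕ) : Module.End F (Grassmann F n) :=
  (CliffordAlgebra.involute (Q := (0 : QuadraticForm F (Fin n → F)))).toLinearMap

variable {F}

/-- The component of parity `p` of an operator on `Λ(n)`, so that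
`A = component 0 A + component 1 A` (the characteristic is not `2`). -/
def component (p : ZMod 2) (A : Module.End F (Grassmann F n)) : Module.End F (Grassmann F n) :=
  (2⁻¹ : F) • (A + (-1 : F) ^ p.val • (parity F n * A * parity F n))

/-- The supercommutator `[A, B] = AB - (-1)^{|A||B|} BA`, extended bilinearly from homogeneous
operators to all operators on `Λ(n)`. -/
def superBracket (A B : Module.End F (Grassmann F n)) : Module.End F (Grassmann F n) :=
  ∑ p : ZMod 2, ∑ q : ZMod 2,
    (component p A * component q B - (-1 : F) ^ (p * q).val • (component q B * component p A))

/-- The subalgebra generated by a set: the smallest subspace containing it and closed under the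
superbracket. It is not required to be compatible with the parity. -/
def generated (X : Set (Module.End F (Grassmann F n))) :
    Submodule F (Module.End F (Grassmann F n)) :=
  sInf {N | X ⊆ N ∧ ∀ a ∈ N, ∀ b ∈ N, superBracket a b ∈ N}

variable (F)

/-- The superderivations of `Λ(n)` of parity `p`. -/
def superDer (n : ℕ) (p : ZMod 2) : Submodule F (Module.End F (Grassmann F n)) where
  carrier := {D | (∀ q, ∀ a ∈ part F n q, D a ∈ part F n (p + q)) ∧
    ∀ q, ∀ a ∈ part F n q, ∀ b, D (a * b) = D a * b + (-1 : F) ^ (p * q).val • (a * D b)}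
  zero_mem' := ⟨fun _ _ _ => by simp, fun _ _ _ _ => by simp⟩
  add_mem' := by
    rintro D E ⟨h1, h2⟩ ⟨h3, h4⟩
    refine ⟨fun q a ha => ?_, fun q a ha b => ?_⟩
    · exact Submodule.add_mem _ (h1 q a ha) (h3 q a ha)
    · simp only [LinearMap.add_apply, h2 q a ha b, h4 q a ha b, add_mul, mul_add, smul_add]
      abel
  smul_mem' := by
    rintro c D ⟨h1, h2⟩
    refine ⟨fun q a ha => ?_, fun q a ha b => ?_⟩
    · exact Submodule.smul_mem _ c (h1 q a ha)
    · simp only [LinearMap.smul_apply, h2 q a ha b, smul_add, smul_mul_assoc, mul_smul_comm,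
        smul_comm c]

/-- `W(n) = der Λ(n)`. -/
def W (n : ℕ) : Submodule F (Module.End F (Grassmann F n)) := ⨆ p : ZMod 2, superDer F n p

/-- `W(n)_k`, spanned by the `x^u ∂/∂ξ_i` with `|u| = k + 1`. -/
def Wdeg (n : ℕ) (k : ℤ) : Submodule F (Module.End F (Grassmann F n)) :=
  Submodule.span F {D | ∃ (u : Finset (Fin n)) (i : Fin n),
    (u.card : ℤ) = k + 1 ∧ D = fpd F (mono F u) i}

/-- `D_{ij}(f) = ∂f/∂ξ_i ∂/∂ξ_j + ∂f/∂ξ_j ∂/∂ξ_i`. -/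
def Dij (i j : Fin n) (f : Grassmann F n) : Module.End F (Grassmann F n) :=
  fpd F (pd F i f) j + fpd F (pd F j f) i

/-- `S(n)_k`, spanned by the `D_{ij}(x^u)` with `|u| = k + 2`. -/
def Sdeg (n : ℕ) (k : ℤ) : Submodule F (Module.End F (Grassmann F n)) :=
  Submodule.span F {D | ∃ (u : Finset (Fin n)) (i j : Fin n),
    (u.card : ℤ) = k + 2 ∧ D = Dij F i j (mono F u)}

/-- `S(n) = S(n)_{-1} + ⋯ + S(n)_{n-2}`. -/
def S (n : ℕ) : Submodule F (Module.End F (Grassmann F n)) :=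
  ⨆ k ∈ Set.Icc (-1 : ℤ) (n - 2), Sdeg F n k

/-- `S̃(2m)_k`: for `k = -1` spanned by the `(1 + ξ_1 ⋯ ξ_{2m}) ∂/∂ξ_j`, and equal to `S(2m)_k`
for `k ≥ 0`. -/
def Stdeg (m : ℕ) (k : ℤ) : Submodule F (Module.End F (Grassmann F (2 * m))) :=
  if k = -1 then Submodule.span F (Set.range fun j => fpd F (1 + mono F Finset.univ) j)
  else Sdeg F (2 * m) k

/-- `S̃(2m) = S̃(2m)_{-1} + ⋯ + S̃(2m)_{2m-2}`. -/
def St (m : ℕ) : Submodule F (Module.End F (Grassmann F (2 * m))) :=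
  ⨆ k ∈ Set.Icc (-1 : ℤ) (2 * m - 2), Stdeg F m k

/-- The involution `i ↦ i'` of the indices: with `m = ⌊n/2⌋` it exchanges the `i`-th and the
`(i+m)`-th index for the first `m` indices `i`, and it fixes the last index if `n` is odd. -/
def prime (i : Fin n) : Fin n :=
  if h : i.val < n / 2 then ⟨i.val + n / 2, by omega⟩
  else if i.val < 2 * (n / 2) then ⟨i.val - n / 2, by omega⟩
  else i

/-- `D_H(x^u) = (-1)^{|u|} ∑_i ∂(x^u)/∂ξ_i ∂/∂ξ_{i'}`. -/
def DH (u : Finset (Fin n)) : Module.End F (Grassmann F n) :=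
  (-1 : F) ^ u.card • ∑ i, fpd F (pd F i (mono F u)) (prime i)

/-- `H(n)_k`, spanned by the `D_H(x^u)` with `|u| = k + 2`. -/
def Hdeg (n : ℕ) (k : ℤ) : Submodule F (Module.End F (Grassmann F n)) :=
  Submodule.span F {D | ∃ u : Finset (Fin n), (u.card : ℤ) = k + 2 ∧ D = DH F u}

/-- `H(n) = H(n)_{-1} + ⋯ + H(n)_{n-3}`. -/
def H (n : ℕ) : Submodule F (Module.End F (Grassmann F n)) :=
  ⨆ k ∈ Set.Icc (-1 : ℤ) (n - 3), Hdeg F n k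

/-- The standard Cartan subalgebra of `W(n)_0 ≅ gl(n)`. -/
def cartanW (n : ℕ) : Submodule F (Module.End F (Grassmann F n)) :=
  Submodule.span F (Set.range fun i : Fin n => fpd F (xi F i) i)

/-- The standard Cartan subalgebra of `S(n)_0 ≅ sl(n)`, also used for `S̃(2m)` with `n = 2m`. -/
def cartanS (n : ℕ) : Submodule F (Module.End F (Grassmann F n)) :=
  Submodule.span F {D | ∃ i j : Fin n, D = fpd F (xi F i) i - fpd F (xi F j) j}

/-- The standard Cartan subalgebra of `H(n)_0 ≅ so(n)`. -/
def cartanH (n : ℕ) : Submodule F (Module.End F (Grassmann F n)) :=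
  Submodule.span F {D | ∃ i : Fin n, i.val < n / 2 ∧
    D = fpd F (xi F i) i - fpd F (xi F (prime i)) (prime i)}

variable {F}

/-- `v` is a (nonzero) weight vector of weight `α` in `V` relative to `𝔥`. -/
def IsWeightVector (𝔥 V : Submodule F (Module.End F (Grassmann F n))) (α : Module.Dual F 𝔥)
    (v : Module.End F (Grassmann F n)) : Prop :=
  v ∈ V ∧ v ≠ 0 ∧ ∀ h : 𝔥, superBracket (h : Module.End F (Grassmann F n)) v = α h • v

/-- `Ω_Φ`: the vectors on which the elements of the finite set `Φ` of linear functions take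
pairwise distinct values. -/
def Omega {V : Type*} [AddCommMonoid V] [Module F V] (Φ : Finset (Module.Dual F V)) : Set V :=
  {v | ∀ f ∈ Φ, ∀ g ∈ Φ, f ≠ g → f v ≠ g v}

/-- There are weight vectors `x₋₁ ∈ L₋₁` and `y_1, …, y_r ∈ L_t` of pairwise distinct weights
and an element `x₀ ∈ L₀` such that, for generic `h ∈ 𝔥`, the elements `x₀` and `h` generate `L₀`
and the two elements `x = x₋₁ + x₀ + y_1 + ⋯ + y_r` and `h` generate `L`. -/
def HasCartanGenerators (r : ℕ) (L Lneg L₀ Lt 𝔥 : Submodule F (Module.End F (Grassmann F n))) :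
    Prop :=
  ∃ (α : Module.Dual F 𝔥) (β : Fin r → Module.Dual F 𝔥)
    (xneg x₀ : Module.End F (Grassmann F n)) (y : Fin r → Module.End F (Grassmann F n)),
    IsWeightVector 𝔥 Lneg α xneg ∧ x₀ ∈ L₀ ∧ (∀ i, IsWeightVector 𝔥 Lt (β i) (y i)) ∧
    (∀ i, β i ≠ α) ∧ Function.Injective β ∧
    ∃ Φ : Finset (Module.Dual F 𝔥), (Omega Φ).Nonempty ∧
      ∀ h : 𝔥, h ∈ Omega Φ →
        generated {x₀, (h : Module.End F (Grassmann F n))} = L₀ ∧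
        generated {xneg + x₀ + ∑ i, y i, (h : Module.End F (Grassmann F n))} = L

end CartanSuper

end

/-!
For generic `h ∈ 𝔥` the weights involved take pairwise distinct values at `h`, so a
bracket-closed subspace that contains `h` and a sum of weight vectors of distinct weights contains
each summand: they are eigenvectors of `ad h` with distinct eigenvalues. Take for `x₀` a sum of root
vectors that generate `L₀` (for `W(n)`, together with `h`). Then `h` and `x₋₁ + x₀ + y₁ + ⋯ + y_r`
generate `x₋₁`, each `y_i` and all of `L₀`, and bracketing with `L₀` moves `x₋₁` to a basis of
`L₋₁`. For `W(n)` and `S(n)` it also moves `y₁` to the whole of the top degree `L_t`, from which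
`L₋₁` lowers to the remaining degrees; for `S̃(2m)` the top degree is already `[L₋₁, L₋₁]`. For
`H(n)` it moves `y₁` to the whole of `L₁`, which raises to the remaining degrees; here the
computations take place on `Λ(n)` itself with its Poisson bracket, which `D_H` maps to the
supercommutator up to sign.
-/

noncomputable section

namespace CartanSuper

section GrassmannAlgebra

variable {F : Type*} [Field F] {n : ℕ}

theorem parity_mul (a b : Grassmann F n) : parity F n (a * b) = parity F n a * parity F n b :=
  map_mul (CliffordAlgebra.involute (Q := (0 : QuadraticForm F (Fin n → F)))) a b

@[simp] theorem parity_one : parity F n 1 = 1 :=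
  map_one (CliffordAlgebra.involute (Q := (0 : QuadraticForm F (Fin n → F))))

@[simp] theorem parity_parity (a : Grassmann F n) : parity F n (parity F n a) = a :=
  CliffordAlgebra.involute_involute a

@[simp] theorem parity_xi (i : Fin n) : parity F n (xi F i) = -xi F i :=
  CliffordAlgebra.involute_ι _

theorem xi_mul_self (i : Fin n) : xi F i * xi F i = 0 := ExteriorAlgebra.ι_sq_zero _

theorem xi_mul_xi (i j : Fin n) : xi F i * xi F j = -(xi F j * xi F i) :=
  eq_neg_of_add_eq_zero_left (ExteriorAlgebra.ι_add_mul_swap _ _)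

theorem ι_eq_sum_xi (v : Fin n → F) : ExteriorAlgebra.ι F v = ∑ i, v i • xi F i := by
  refine (LinearMap.pi_apply_eq_sum_univ (ExteriorAlgebra.ι F) v).trans
    (Finset.sum_congr rfl fun i _ => ?_)
  congr 2
  ext j
  simp [Pi.single_apply, eq_comm]

@[elab_as_elim]
theorem grassmann_induction {P : Grassmann F n → Prop} (one : P 1)
    (add : ∀ a b, P a → P b → P (a + b)) (smul : ∀ (c : F) a, P a → P (c • a))
    (xi_mul : ∀ i a, P a → P (xi F i * a)) (a : Grassmann F n) : P a := by
  refine CliffordAlgebra.left_induction (0 : QuadraticForm F (Fin n → F)) (P := P)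
    (fun r => ?_) add (fun x v hx => ?_) a
  · rw [Algebra.algebraMap_eq_smul_one]
    exact smul r 1 one
  · change P (ExteriorAlgebra.ι F v * x)
    rw [ι_eq_sum_xi, Finset.sum_mul]
    refine Finset.sum_induction _ P add (by simpa using smul 0 1 one) fun i _ => ?_
    rw [smul_mul_assoc]
    exact smul _ _ (xi_mul i x hx)

@[simp] theorem pd_one (i : Fin n) : pd F i 1 = 0 :=
  CliffordAlgebra.contractLeft_one (Q := (0 : QuadraticForm F (Fin n → F))) _

theorem pd_xi_mul (i j : Fin n) (b : Grassmann F n) :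
    pd F i (xi F j * b) = (if i = j then b else 0) - xi F j * pd F i b := by
  refine (CliffordAlgebra.contractLeft_ι_mul (Q := (0 : QuadraticForm F (Fin n → F)))
    (LinearMap.proj i) (Pi.single j 1) b).trans ?_
  congr 1
  by_cases h : i = j <;> simp [h]

@[simp] theorem pd_xi (i j : Fin n) : pd F i (xi F j) = if i = j then 1 else 0 := by
  simpa using pd_xi_mul (F := F) i j 1

theorem pd_pd (i j : Fin n) (a : Grassmann F n) : pd F i (pd F j a) = -pd F j (pd F i a) :=
  CliffordAlgebra.contractLeft_comm _ _ _

theorem pd_mul (i : Fin n) (a b : Grassmann F n) :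
    pd F i (a * b) = pd F i a * b + parity F n a * pd F i b := by
  induction a using grassmann_induction with
  | one => simp
  | add a c ha hc => simp only [add_mul, map_add, ha, hc]; abel
  | smul c a ha => simp only [smul_mul_assoc, map_smul, ha, smul_add]
  | xi_mul j a ha =>
    rw [mul_assoc, pd_xi_mul, ha, pd_xi_mul, parity_mul, parity_xi]
    split_ifs <;> noncomm_ring

theorem pd_parity (i : Fin n) (a : Grassmann F n) :
    pd F i (parity F n a) = -parity F n (pd F i a) := by
  induction a using grassmann_induction with
  | one => simp
  | add a c ha hc => simp only [map_add, ha, hc]; abel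
  | smul c a ha => simp only [map_smul, ha, smul_neg]
  | xi_mul j a ha =>
    rw [parity_mul, parity_xi, neg_mul, map_neg, pd_xi_mul, ha, pd_xi_mul, map_sub, parity_mul,
      parity_xi]
    split_ifs <;> simp

theorem mul_xi (a : Grassmann F n) (i : Fin n) : a * xi F i = xi F i * parity F n a := by
  induction a using grassmann_induction with
  | one => simp
  | add a c ha hc => simp only [add_mul, map_add, ha, hc, mul_add]
  | smul c a ha => simp only [smul_mul_assoc, map_smul, ha, mul_smul_comm]
  | xi_mul j a ha =>
    rw [mul_assoc, ha, parity_mul, parity_xi, ← mul_assoc, ← mul_assoc, xi_mul_xi j i]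
    simp

theorem mul_eq_mul_of_parity_eq_self {a : Grassmann F n} (ha : parity F n a = a)
    (b : Grassmann F n) : a * b = b * a := by
  induction b using grassmann_induction with
  | one => simp
  | add b c hb hc => simp only [add_mul, mul_add, hb, hc]
  | smul c b hb => simp only [smul_mul_assoc, mul_smul_comm, hb]
  | xi_mul j b hb => rw [← mul_assoc, mul_xi, ha, mul_assoc, hb, mul_assoc]

theorem mul_eq_parity_mul_of_parity_eq_neg {a : Grassmann F n} (ha : parity F n a = -a)
    (b : Grassmann F n) : a * b = parity F n b * a := by
  induction b using grassmann_induction with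
  | one => simp
  | add b c hb hc => simp only [add_mul, mul_add, hb, hc, map_add]
  | smul c b hb => simp only [smul_mul_assoc, mul_smul_comm, hb, map_smul]
  | xi_mul j b hb =>
    rw [← mul_assoc, mul_xi, ha, mul_assoc, neg_mul, hb, parity_mul, parity_xi]
    noncomm_ring

end GrassmannAlgebra

section Parity

variable {F : Type*} [Field F] {n : ℕ}

@[simp] theorem val_one_zmod_two : (1 : ZMod 2).val = 1 := rfl

theorem zmod_two_eq_zero_or_one (p : ZMod 2) : p = 0 ∨ p = 1 := by
  revert p
  decide

theorem neg_one_pow_val_add (p q : ZMod 2) :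
    (-1 : F) ^ (p + q).val = (-1 : F) ^ p.val * (-1 : F) ^ q.val := by
  obtain rfl | rfl := zmod_two_eq_zero_or_one p <;>
    obtain rfl | rfl := zmod_two_eq_zero_or_one q <;> simp [CharTwo.add_self_eq_zero]

theorem parity_of_mem_part {p : ZMod 2} {a : Grassmann F n} (ha : a ∈ part F n p) :
    parity F n a = (-1 : F) ^ p.val • a := by
  obtain rfl | rfl := zmod_two_eq_zero_or_one p
  · exact (CliffordAlgebra.involute_eq_of_mem_even ha).trans (by simp)
  · exact (CliffordAlgebra.involute_eq_of_mem_odd ha).trans (by simp)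

theorem exists_add_of_parts (a : Grassmann F n) :
    ∃ a₀ ∈ part F n 0, ∃ a₁ ∈ part F n 1, a₀ + a₁ = a :=
  Submodule.mem_sup.1
    ((CliffordAlgebra.evenOdd_isCompl (Q := (0 : QuadraticForm F (Fin n → F)))).sup_eq_top ▸
      Submodule.mem_top)

theorem mul_comm_of_mem_part {p q : ZMod 2} {a b : Grassmann F n} (ha : a ∈ part F n p)
    (hb : b ∈ part F n q) : a * b = (-1 : F) ^ (p * q).val • (b * a) := by
  have hpa := parity_of_mem_part ha
  obtain rfl | rfl := zmod_two_eq_zero_or_one p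
  · simpa using mul_eq_mul_of_parity_eq_self (by simpa using hpa) b
  · rw [mul_eq_parity_mul_of_parity_eq_neg (by simpa using hpa), parity_of_mem_part hb, one_mul,
      smul_mul_assoc]

variable [NeZero (2 : F)]

theorem mem_part_iff {p : ZMod 2} {a : Grassmann F n} :
    a ∈ part F n p ↔ parity F n a = (-1 : F) ^ p.val • a := by
  refine ⟨parity_of_mem_part, fun h => ?_⟩
  have eq_zero_of_eq_neg : ∀ b : Grassmann F n, b = -b → b = 0 := fun b hb => by
    have : (2 : F) • b = 0 := by rw [two_smul]; exact eq_neg_iff_add_eq_zero.1 hb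
    exact (smul_eq_zero.1 this).resolve_left two_ne_zero
  obtain ⟨a₀, ha₀, a₁, ha₁, rfl⟩ := exists_add_of_parts a
  rw [map_add, parity_of_mem_part ha₀, parity_of_mem_part ha₁] at h
  obtain rfl | rfl := zmod_two_eq_zero_or_one p
  · rwa [eq_zero_of_eq_neg a₁ (by simpa using h.symm), add_zero]
  · rwa [eq_zero_of_eq_neg a₀ (by simpa [add_comm] using h), zero_add]

theorem xi_mem_part (i : Fin n) : xi F i ∈ part F n 1 := mem_part_iff.2 (by simp)

theorem pd_mem_part {p : ZMod 2} {a : Grassmann F n} (ha : a ∈ part F n p) (i : Fin n) :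
    pd F i a ∈ part F n (p + 1) := by
  rw [mem_part_iff] at ha ⊢
  rw [neg_one_pow_val_add, ← neg_inj, ← pd_parity, ha]
  simp

end Parity

section SuperBracket

variable {F : Type*} [Field F] {n : ℕ}

theorem neg_smul_end (c : F) (A : Module.End F (Grassmann F n)) : -c • A = -(c • A) :=
  neg_smul c A

theorem sub_smul_end (a b : F) (A : Module.End F (Grassmann F n)) :
    (a - b) • A = a • A - b • A :=
  sub_smul a b A

/-- `component` as a linear map in the operator. -/
def componentₗ (p : ZMod 2) :
    Module.End F (Grassmann F n) →ₗ[F] Module.End F (Grassmann F n) where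
  toFun A := component p A
  map_add' A B := by simp only [component, mul_add, add_mul, smul_add]; abel
  map_smul' c A := by
    simp only [component, mul_smul_comm, smul_mul_assoc, smul_add, RingHom.id_apply]
    rw [smul_comm c, smul_comm c (2⁻¹ : F), smul_comm c]

/-- The superbracket as a bilinear map. -/
def superBracketₗ : Module.End F (Grassmann F n) →ₗ[F] Module.End F (Grassmann F n) →ₗ[F]
    Module.End F (Grassmann F n) :=
  let mulₗ := LinearMap.mul F (Module.End F (Grassmann F n))
  ∑ p : ZMod 2, ∑ q : ZMod 2,
    (mulₗ.compl₁₂ (componentₗ p) (componentₗ q) +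
      (-(-1 : F) ^ (p * q).val) • mulₗ.flip.compl₁₂ (componentₗ p) (componentₗ q))

theorem superBracketₗ_apply (A B : Module.End F (Grassmann F n)) :
    superBracketₗ A B = superBracket A B := by
  simp only [superBracketₗ, superBracket, LinearMap.sum_apply, LinearMap.add_apply,
    LinearMap.smul_apply, LinearMap.compl₁₂_apply, LinearMap.flip_apply, LinearMap.mul_apply',
    sub_eq_add_neg, neg_smul_end]
  rfl

theorem superBracket_add_left (A B C : Module.End F (Grassmann F n)) :
    superBracket (A + B) C = superBracket A C + superBracket B C := by
  simp only [← superBracketₗ_apply, map_add, LinearMap.add_apply]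

theorem superBracket_add_right (A B C : Module.End F (Grassmann F n)) :
    superBracket A (B + C) = superBracket A B + superBracket A C := by
  simp only [← superBracketₗ_apply, map_add]

theorem superBracket_smul_left (c : F) (A B : Module.End F (Grassmann F n)) :
    superBracket (c • A) B = c • superBracket A B := by
  simp only [← superBracketₗ_apply, map_smul, LinearMap.smul_apply]

theorem superBracket_sum_left {ι : Type*} (s : Finset ι) (A : ι → Module.End F (Grassmann F n))
    (B : Module.End F (Grassmann F n)) :
    superBracket (∑ k ∈ s, A k) B = ∑ k ∈ s, superBracket (A k) B := by
  simp only [← superBracketₗ_apply, map_sum, LinearMap.sum_apply]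

theorem superBracket_sum_right {ι : Type*} (s : Finset ι) (A : Module.End F (Grassmann F n))
    (B : ι → Module.End F (Grassmann F n)) :
    superBracket A (∑ k ∈ s, B k) = ∑ k ∈ s, superBracket A (B k) := by
  simp only [← superBracketₗ_apply, map_sum]

variable [NeZero (2 : F)]

theorem component_of_parity_conj {p : ZMod 2} {A : Module.End F (Grassmann F n)}
    (hA : parity F n * A * parity F n = (-1 : F) ^ p.val • A) (q : ZMod 2) :
    component q A = if q = p then A else 0 := by
  have half : (2⁻¹ : F) • (A + A) = A := by
    rw [← two_smul F A, smul_smul, inv_mul_cancel₀ two_ne_zero, one_smul]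
  obtain rfl | rfl := zmod_two_eq_zero_or_one p <;>
    obtain rfl | rfl := zmod_two_eq_zero_or_one q <;> simp [component, hA, half, neg_smul_end]

theorem superBracket_of_parity_conj {p q : ZMod 2} {A B : Module.End F (Grassmann F n)}
    (hA : parity F n * A * parity F n = (-1 : F) ^ p.val • A)
    (hB : parity F n * B * parity F n = (-1 : F) ^ q.val • B) :
    superBracket A B = A * B - (-1 : F) ^ (p * q).val • (B * A) := by
  rw [superBracket, Fintype.sum_eq_single p, Fintype.sum_eq_single q]
  · simp [component_of_parity_conj hA, component_of_parity_conj hB]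
  · intro q' hq'
    simp [component_of_parity_conj hB, hq']
  · intro p' hp'
    simp [component_of_parity_conj hA, hp']

theorem superBracket_mem_of_swap_mem {p q : ZMod 2} {A B : Module.End F (Grassmann F n)}
    (hA : parity F n * A * parity F n = (-1 : F) ^ p.val • A)
    (hB : parity F n * B * parity F n = (-1 : F) ^ q.val • B)
    {V : Submodule F (Module.End F (Grassmann F n))} (h : superBracket A B ∈ V) :
    superBracket B A ∈ V := by
  rw [superBracket_of_parity_conj hA hB] at h
  rw [superBracket_of_parity_conj hB hA, mul_comm q p]
  have := Submodule.smul_mem _ (-(-1 : F) ^ (p * q).val) h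
  rwa [smul_sub, smul_smul, neg_mul, ← mul_pow, neg_one_mul, neg_neg, one_pow, neg_smul, neg_smul,
    one_smul, sub_neg_eq_add, neg_add_eq_sub] at this

end SuperBracket

section VectorFields

variable {F : Type*} [Field F] {n : ℕ}

theorem fpd_apply (f : Grassmann F n) (i : Fin n) (a : Grassmann F n) :
    fpd F f i a = f * pd F i a := rfl

/-- `fpd` as a linear map in the coefficient. -/
def fpdₗ (i : Fin n) : Grassmann F n →ₗ[F] Module.End F (Grassmann F n) where
  toFun f := fpd F f i
  map_add' f g := LinearMap.ext fun a => by simp [fpd_apply, add_mul]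
  map_smul' c f := LinearMap.ext fun a => by simp [fpd_apply]

theorem fpdₗ_apply (f : Grassmann F n) (i : Fin n) : fpdₗ i f = fpd F f i := rfl

theorem fpd_add (f g : Grassmann F n) (i : Fin n) : fpd F (f + g) i = fpd F f i + fpd F g i :=
  map_add (fpdₗ i) f g

theorem fpd_sub (f g : Grassmann F n) (i : Fin n) : fpd F (f - g) i = fpd F f i - fpd F g i :=
  map_sub (fpdₗ i) f g

theorem fpd_neg (f : Grassmann F n) (i : Fin n) : fpd F (-f) i = -fpd F f i :=
  map_neg (fpdₗ i) f

theorem fpd_smul (c : F) (f : Grassmann F n) (i : Fin n) : fpd F (c • f) i = c • fpd F f i :=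
  map_smul (fpdₗ i) c f

@[simp] theorem fpd_zero (i : Fin n) : fpd F 0 i = 0 := map_zero (fpdₗ (F := F) i)

theorem fpd_sum {ι : Type*} (s : Finset ι) (f : ι → Grassmann F n) (i : Fin n) :
    fpd F (∑ k ∈ s, f k) i = ∑ k ∈ s, fpd F (f k) i :=
  map_sum (fpdₗ i) f s

theorem fpd_ne_zero {f : Grassmann F n} (hf : f ≠ 0) (i : Fin n) : fpd F f i ≠ 0 := fun h =>
  hf (by simpa [fpd_apply] using LinearMap.congr_fun h (xi F i))

theorem parity_conj_fpd {p : ZMod 2} {f : Grassmann F n} (hf : f ∈ part F n p) (i : Fin n) :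
    parity F n * fpd F f i * parity F n = (-1 : F) ^ (p + 1).val • fpd F f i := by
  refine LinearMap.ext fun x => ?_
  rw [neg_one_pow_val_add]
  simp [fpd_apply, parity_mul, pd_parity, parity_of_mem_part hf]

variable [NeZero (2 : F)]

theorem superBracket_fpd_fpd_of_mem_part {p q : ZMod 2} {f g : Grassmann F n}
    (hf : f ∈ part F n p) (hg : g ∈ part F n q) (i j : Fin n) :
    superBracket (fpd F f i) (fpd F g j) =
      fpd F (f * pd F i g) j + fpd F (pd F j (parity F n f) * g) i := by
  have hgf : g * f = (-1 : F) ^ (q * p).val • (f * g) := mul_comm_of_mem_part hg hf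
  have hgpdf : g * pd F j f = (-1 : F) ^ (q * (p + 1)).val • (pd F j f * g) :=
    mul_comm_of_mem_part hg (pd_mem_part hf j)
  rw [superBracket_of_parity_conj (parity_conj_fpd hf i) (parity_conj_fpd hg j)]
  refine LinearMap.ext fun x => ?_
  simp only [LinearMap.sub_apply, LinearMap.smul_apply, LinearMap.add_apply,
    Module.End.mul_apply, fpd_apply, pd_mul, parity_of_mem_part hf, parity_of_mem_part hg,
    map_smul, pd_pd j i x, mul_add, smul_mul_assoc, mul_smul_comm, mul_neg, ← mul_assoc, hgf, hgpdf]
  obtain rfl | rfl := zmod_two_eq_zero_or_one p <;>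
    obtain rfl | rfl := zmod_two_eq_zero_or_one q <;>
    simp [CharTwo.add_self_eq_zero] <;> abel

theorem superBracket_fpd_fpd (f g : Grassmann F n) (i j : Fin n) :
    superBracket (fpd F f i) (fpd F g j) =
      fpd F (f * pd F i g) j + fpd F (pd F j (parity F n f) * g) i := by
  obtain ⟨f₀, hf₀, f₁, hf₁, rfl⟩ := exists_add_of_parts f
  obtain ⟨g₀, hg₀, g₁, hg₁, rfl⟩ := exists_add_of_parts g
  simp only [fpd_add, superBracket_add_left, superBracket_add_right,
    superBracket_fpd_fpd_of_mem_part hf₀ hg₀, superBracket_fpd_fpd_of_mem_part hf₀ hg₁,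
    superBracket_fpd_fpd_of_mem_part hf₁ hg₀, superBracket_fpd_fpd_of_mem_part hf₁ hg₁,
    map_add, add_mul, mul_add]
  abel

end VectorFields

section Monomials

variable {F : Type*} [Field F] {n : ℕ}

theorem mem_iff_of_eq_or_eq_neg {M : Type*} [AddCommGroup M] [Module F M] {V : Submodule F M}
    {a b : M} (h : a = b ∨ a = -b) : a ∈ V ↔ b ∈ V := by
  rcases h with rfl | rfl
  · rfl
  · exact V.neg_mem_iff

variable (F) in
/-- The product `ξ_{i_1} ⋯ ξ_{i_k}` along a list of indices, which may be unsorted and may have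
repetitions. -/
def prodXi (l : List (Fin n)) : Grassmann F n := (l.map (xi F)).prod

@[simp] theorem prodXi_nil : prodXi F ([] : List (Fin n)) = 1 := rfl

theorem prodXi_cons (i : Fin n) (l : List (Fin n)) : prodXi F (i :: l) = xi F i * prodXi F l := by
  simp [prodXi]

theorem prodXi_append (l l' : List (Fin n)) :
    prodXi F (l ++ l') = prodXi F l * prodXi F l' := by
  simp [prodXi]

theorem mono_eq_prodXi (u : Finset (Fin n)) : mono F u = prodXi F (u.sort (· ≤ ·)) := rfl

theorem prodXi_perm {l l' : List (Fin n)} (h : l.Perm l') :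
    prodXi F l = prodXi F l' ∨ prodXi F l = -prodXi F l' := by
  induction h with
  | nil => exact Or.inl rfl
  | cons i _ ih =>
    rw [prodXi_cons, prodXi_cons]
    rcases ih with h | h <;> simp [h]
  | swap i j l =>
    right
    simp only [prodXi_cons, ← mul_assoc]
    rw [xi_mul_xi j i, neg_mul]
  | trans _ _ h1 h2 =>
    rcases h1 with h1 | h1 <;> rcases h2 with h2 | h2 <;> simp [h1, h2]

theorem xi_mul_prodXi_of_mem {i : Fin n} {l : List (Fin n)} (h : i ∈ l) :
    xi F i * prodXi F l = 0 := by
  induction l with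
  | nil => simp at h
  | cons j l ih =>
    rw [prodXi_cons]
    rcases List.mem_cons.1 h with rfl | h
    · rw [← mul_assoc, xi_mul_self, zero_mul]
    · rw [← mul_assoc, xi_mul_xi, neg_mul, mul_assoc, ih h, mul_zero, neg_zero]

theorem prodXi_eq_zero {l : List (Fin n)} (h : ¬l.Nodup) : prodXi F l = 0 := by
  induction l with
  | nil => simp at h
  | cons i l ih =>
    rw [prodXi_cons]
    by_cases hi : i ∈ l
    · exact xi_mul_prodXi_of_mem hi
    · rw [ih (fun hl => h (List.nodup_cons.2 ⟨hi, hl⟩)), mul_zero]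

theorem prodXi_eq_mono {l : List (Fin n)} (h : l.Nodup) :
    prodXi F l = mono F l.toFinset ∨ prodXi F l = -mono F l.toFinset := by
  rw [mono_eq_prodXi]
  refine prodXi_perm ?_
  rw [List.perm_ext_iff_of_nodup h (Finset.sort_nodup _ _)]
  simp

@[simp] theorem mono_empty : mono F (∅ : Finset (Fin n)) = 1 := by simp [mono]

@[simp] theorem mono_singleton (i : Fin n) : mono F {i} = xi F i := by simp [mono]

theorem xi_mul_mono_of_notMem {i : Fin n} {u : Finset (Fin n)} (h : i ∉ u) :
    xi F i * mono F u = mono F (insert i u) ∨ xi F i * mono F u = -mono F (insert i u) := by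
  have := prodXi_eq_mono (F := F) (l := i :: u.sort (· ≤ ·))
    (List.nodup_cons.2 ⟨by simpa using h, Finset.sort_nodup _ _⟩)
  simpa [prodXi_cons, mono_eq_prodXi] using this

theorem xi_mul_mono_of_mem {i : Fin n} {u : Finset (Fin n)} (h : i ∈ u) :
    xi F i * mono F u = 0 :=
  xi_mul_prodXi_of_mem (by simpa using h)

theorem mono_eq_xi_mul {i : Fin n} {u : Finset (Fin n)} (h : i ∈ u) :
    mono F u = xi F i * mono F (u.erase i) ∨ mono F u = -(xi F i * mono F (u.erase i)) := by
  have := xi_mul_mono_of_notMem (F := F) (Finset.notMem_erase i u)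
  rw [Finset.insert_erase h] at this
  rcases this with h | h <;> simp [h]

theorem pd_prodXi_of_notMem {i : Fin n} {l : List (Fin n)} (h : i ∉ l) :
    pd F i (prodXi F l) = 0 := by
  induction l with
  | nil => simp
  | cons j l ih =>
    obtain ⟨hij, hil⟩ := List.ne_and_not_mem_of_not_mem_cons h
    simp [prodXi_cons, pd_xi_mul, hij, ih hil]

theorem pd_mono_of_notMem {i : Fin n} {u : Finset (Fin n)} (h : i ∉ u) :
    pd F i (mono F u) = 0 :=
  pd_prodXi_of_notMem (by simpa using h)

theorem pd_mono_of_mem {i : Fin n} {u : Finset (Fin n)} (h : i ∈ u) :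
    pd F i (mono F u) = mono F (u.erase i) ∨ pd F i (mono F u) = -mono F (u.erase i) := by
  have h0 := pd_mono_of_notMem (F := F) (Finset.notMem_erase i u)
  rcases mono_eq_xi_mul (F := F) h with h | h <;> simp [h, pd_xi_mul, h0]

theorem xi_mul_pd_mono (i : Fin n) (u : Finset (Fin n)) :
    xi F i * pd F i (mono F u) = if i ∈ u then mono F u else 0 := by
  split_ifs with h
  · have h0 := pd_mono_of_notMem (F := F) (Finset.notMem_erase i u)
    rcases mono_eq_xi_mul (F := F) h with h | h <;> rw [h] <;> simp [pd_xi_mul, h0]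
  · rw [pd_mono_of_notMem h, mul_zero]

theorem xi_mul_pd_mono_of_ne {i j : Fin n} (hij : i ≠ j) {u : Finset (Fin n)} (h : i ∈ u) :
    xi F i * pd F j (mono F u) = 0 := by
  by_cases hj : j ∈ u
  · rcases pd_mono_of_mem (F := F) hj with h' | h' <;>
      simp [h', xi_mul_mono_of_mem (F := F) (Finset.mem_erase.2 ⟨hij, h⟩)]
  · rw [pd_mono_of_notMem hj, mul_zero]

theorem mono_ne_zero (u : Finset (Fin n)) : mono F u ≠ 0 := by
  induction u using Finset.induction_on with
  | empty => simp
  | insert i u hi ih =>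
    intro h
    rcases pd_mono_of_mem (F := F) (Finset.mem_insert_self i u) with h' | h' <;>
      rw [h, map_zero, Finset.erase_insert hi] at h'
    · exact ih h'.symm
    · exact ih (neg_eq_zero.1 h'.symm)

theorem mono_mem_of_prodXi_mem {V : Submodule F (Grassmann F n)} {l : List (Fin n)}
    {u : Finset (Fin n)} (hl : l.Nodup) (hu : l.toFinset = u) (h : prodXi F l ∈ V) :
    mono F u ∈ V :=
  hu ▸ (mem_iff_of_eq_or_eq_neg (prodXi_eq_mono hl)).1 h

theorem prodXi_mem_of_mono_mem {V : Submodule F (Grassmann F n)} {l : List (Fin n)}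
    (h : l.Nodup → mono F l.toFinset ∈ V) : prodXi F l ∈ V := by
  by_cases hl : l.Nodup
  · exact (mem_iff_of_eq_or_eq_neg (prodXi_eq_mono hl)).2 (h hl)
  · exact prodXi_eq_zero (F := F) hl ▸ V.zero_mem

theorem span_mono : Submodule.span F (Set.range (mono F (n := n))) = ⊤ := by
  rw [Submodule.eq_top_iff']
  intro a
  induction a using grassmann_induction with
  | one => exact Submodule.subset_span ⟨∅, mono_empty⟩
  | add a b ha hb => exact add_mem ha hb
  | smul c a ha => exact Submodule.smul_mem _ _ ha
  | xi_mul i a ha =>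
    suffices Submodule.span F (Set.range (mono F)) ≤
        (Submodule.span F (Set.range (mono F))).comap (LinearMap.mulLeft F (xi F i)) from this ha
    refine Submodule.span_le.2 (Set.range_subset_iff.2 fun u => ?_)
    have : prodXi F (i :: u.sort (· ≤ ·)) ∈ Submodule.span F (Set.range (mono F)) :=
      prodXi_mem_of_mono_mem fun _ => Submodule.subset_span ⟨_, rfl⟩
    rwa [prodXi_cons] at this

variable (F) in
/-- The homogeneous component of degree `k` of `Λ(n)`. -/
def homog (n k : ℕ) : Submodule F (Grassmann F n) :=
  Submodule.span F {a | ∃ u : Finset (Fin n), u.card = k ∧ a = mono F u}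

theorem mono_mem_homog {u : Finset (Fin n)} {k : ℕ} (h : u.card = k) : mono F u ∈ homog F n k :=
  Submodule.subset_span ⟨u, h, rfl⟩

theorem homog_le {k : ℕ} {V : Submodule F (Grassmann F n)}
    (h : ∀ u : Finset (Fin n), u.card = k → mono F u ∈ V) : homog F n k ≤ V :=
  Submodule.span_le.2 (by rintro _ ⟨u, hu, rfl⟩; exact h u hu)

theorem xi_mem_homog (i : Fin n) : xi F i ∈ homog F n 1 := by
  simpa using mono_mem_homog (F := F) (Finset.card_singleton i)

theorem prodXi_mem_homog (l : List (Fin n)) : prodXi F l ∈ homog F n l.length :=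
  prodXi_mem_of_mono_mem fun h => mono_mem_homog (List.toFinset_card_of_nodup h)

theorem homog_eq_bot {k : ℕ} (h : n < k) : homog F n k = ⊥ :=
  eq_bot_iff.2 <| homog_le fun u hu => absurd (card_finset_fin_le u) (by omega)

theorem mul_mem_homog {k l : ℕ} {a b : Grassmann F n} (ha : a ∈ homog F n k)
    (hb : b ∈ homog F n l) : a * b ∈ homog F n (k + l) := by
  suffices homog F n k ≤ (homog F n (k + l)).comap (LinearMap.mulRight F b) from this ha
  refine homog_le fun u hu => ?_
  suffices homog F n l ≤ (homog F n (k + l)).comap (LinearMap.mulLeft F (mono F u)) from this hb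
  refine homog_le fun v hv => ?_
  have := prodXi_mem_homog (F := F) (u.sort (· ≤ ·) ++ v.sort (· ≤ ·))
  simpa [prodXi_append, hu, hv, ← mono_eq_prodXi] using this

theorem mul_eq_zero_of_mem_homog {k l : ℕ} {a b : Grassmann F n} (ha : a ∈ homog F n k)
    (hb : b ∈ homog F n l) (h : n < k + l) : a * b = 0 := by
  simpa [homog_eq_bot h] using mul_mem_homog ha hb

theorem pd_mem_homog {k : ℕ} {a : Grassmann F n} (ha : a ∈ homog F n (k + 1)) (i : Fin n) :
    pd F i a ∈ homog F n k := by
  suffices homog F n (k + 1) ≤ (homog F n k).comap (pd F i) from this ha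
  refine homog_le fun u hu => ?_
  rw [Submodule.mem_comap]
  by_cases h : i ∈ u
  · exact (mem_iff_of_eq_or_eq_neg (pd_mono_of_mem h)).2
      (mono_mem_homog (by rw [Finset.card_erase_of_mem h, hu]; rfl))
  · rw [pd_mono_of_notMem h]
    exact zero_mem _

theorem xi_mul_xi_mem_homog (i j : Fin n) : xi F i * xi F j ∈ homog F n 2 := by
  have := mul_mem_homog (xi_mem_homog (F := F) i) (xi_mem_homog j)
  rwa [one_add_one_eq_two] at this

theorem homog_two_le {V : Submodule F (Grassmann F n)}
    (h : ∀ i j, i ≠ j → xi F i * xi F j ∈ V) : homog F n 2 ≤ V := by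
  refine homog_le fun u hu => ?_
  obtain ⟨i, j, hij, rfl⟩ := Finset.card_eq_two.1 hu
  refine mono_mem_of_prodXi_mem (l := [i, j]) (by simpa using hij) (by simp) ?_
  simpa [prodXi] using h i j hij

theorem mono_mem_of_univ {V : Submodule F (Grassmann F n)} {d : ℕ}
    (hpd : ∀ (l : Fin n) (u : Finset (Fin n)), d < u.card → mono F u ∈ V → pd F l (mono F u) ∈ V)
    (huniv : mono F Finset.univ ∈ V) (u : Finset (Fin n)) (hu : d ≤ u.card) : mono F u ∈ V := by
  induction hk : uᶜ.card generalizing u with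
  | zero =>
    rw [Finset.card_eq_zero, Finset.compl_eq_empty_iff] at hk
    exact hk ▸ huniv
  | succ k ih =>
    obtain ⟨l, hl⟩ : uᶜ.Nonempty := Finset.card_pos.1 (by omega)
    have hlu : l ∉ u := Finset.mem_compl.1 hl
    have hcard : (insert l u).card = u.card + 1 := Finset.card_insert_of_notMem hlu
    have hmem := hpd l (insert l u) (by omega) (ih (insert l u) (by omega) (by
      rw [Finset.compl_insert, Finset.card_erase_of_mem hl, hk, Nat.add_sub_cancel]))
    rwa [mem_iff_of_eq_or_eq_neg (pd_mono_of_mem (Finset.mem_insert_self l u)),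
      Finset.erase_insert hlu] at hmem

theorem parity_prodXi (l : List (Fin n)) :
    parity F n (prodXi F l) = (-1 : F) ^ l.length • prodXi F l := by
  induction l with
  | nil => simp
  | cons i l ih =>
    rw [prodXi_cons, parity_mul, ih, parity_xi, List.length_cons, pow_succ]
    simp

theorem parity_mono (u : Finset (Fin n)) :
    parity F n (mono F u) = (-1 : F) ^ u.card • mono F u := by
  rw [mono_eq_prodXi, parity_prodXi, Finset.length_sort]

theorem parity_of_mem_homog {k : ℕ} {a : Grassmann F n} (ha : a ∈ homog F n k) :
    parity F n a = (-1 : F) ^ k • a := by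
  have : homog F n k ≤ LinearMap.ker (parity F n - (-1 : F) ^ k • LinearMap.id) :=
    homog_le fun u hu => by simp [parity_mono, hu]
  simpa [sub_eq_zero] using this ha

theorem mem_part_of_mem_homog [NeZero (2 : F)] {k : ℕ} {a : Grassmann F n} (ha : a ∈ homog F n k) :
    a ∈ part F n k := by
  rw [mem_part_iff, parity_of_mem_homog ha, ZMod.val_natCast, ← neg_one_pow_eq_pow_mod_two]

theorem parity_mem_homog {k : ℕ} {a : Grassmann F n} (ha : a ∈ homog F n k) :
    parity F n a ∈ homog F n k :=
  parity_of_mem_homog ha ▸ Submodule.smul_mem _ _ ha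

theorem homog_zero : homog F n 0 = Submodule.span F {1} := by
  simp [homog]

/-- The diagonal vector field `∑ c_i ξ_i ∂/∂ξ_i`. -/
def diag : (Fin n → F) →ₗ[F] Module.End F (Grassmann F n) :=
  Fintype.linearCombination F fun i => fpd F (xi F i) i

theorem diag_apply (c : Fin n → F) : diag c = ∑ i, c i • fpd F (xi F i) i := rfl

theorem range_diag : LinearMap.range (diag (F := F) (n := n)) = cartanW F n :=
  Fintype.range_linearCombination F _

theorem diag_mono (c : Fin n → F) (u : Finset (Fin n)) :
    diag c (mono F u) = (∑ i ∈ u, c i) • mono F u := by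
  simp [diag_apply, LinearMap.sum_apply, fpd_apply, xi_mul_pd_mono, Finset.sum_smul]

theorem superBracket_diag_fpd [NeZero (2 : F)] (c : Fin n → F) (g : Grassmann F n) (j : Fin n) :
    superBracket (diag c) (fpd F g j) = fpd F (diag c g) j - c j • fpd F g j := by
  simp only [diag_apply, superBracket_sum_left, superBracket_smul_left, superBracket_fpd_fpd,
    parity_xi, map_neg, pd_xi, LinearMap.sum_apply, LinearMap.smul_apply, fpd_apply, fpd_sum,
    fpd_smul, smul_add, Finset.sum_add_distrib, sub_eq_add_neg]
  congr 1
  rw [Fintype.sum_eq_single j fun i hi => by simp [hi.symm]]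
  simp [fpd_neg]

/-- The coordinate `c_i` of a diagonal vector field. -/
def coord (i : Fin n) : Module.Dual F (Module.End F (Grassmann F n)) :=
  (ExteriorAlgebra.algebraMapInv.toLinearMap ∘ₗ pd F i) ∘ₗ LinearMap.applyₗ (xi F i)

theorem coord_fpd_xi (i j : Fin n) :
    coord i (fpd F (xi F j) j) = if i = j then 1 else 0 := by
  by_cases h : i = j <;> simp [coord, fpd_apply, h, Ne.symm]

@[simp] theorem coord_diag (c : Fin n → F) (i : Fin n) : coord i (diag c) = c i := by
  simp [diag_apply, coord_fpd_xi]

theorem diag_coord_of_mem_cartanW {h : Module.End F (Grassmann F n)} (hh : h ∈ cartanW F n) :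
    diag (fun i => coord i h) = h := by
  obtain ⟨c, rfl⟩ := range_diag (F := F) (n := n) ▸ hh
  simp only [coord_diag]

theorem diag_mem_cartanW (c : Fin n → F) : diag c ∈ cartanW F n :=
  range_diag (F := F) (n := n) ▸ LinearMap.mem_range_self _ _

end Monomials

section Eigenvectors

variable {F V ι : Type*} [Field F] [AddCommGroup V] [Module F V]

-- In the quotient by `N` the images of the `v i` lie in independent eigenspaces and have sum zero.
theorem mem_of_sum_eigenvectors_mem [Fintype ι] {T : Module.End F V} {N : Submodule F V}
    (hN : N ≤ N.comap T) {v : ι → V} {c : ι → F} (hv : ∀ i, T (v i) = c i • v i)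
    (hc : Function.Injective c) (hs : ∑ i, v i ∈ N) (i : ι) : v i ∈ N := by
  let quotT : Module.End F (V ⧸ N) := N.mapQ N T hN
  have indep : iSupIndep fun i => quotT.eigenspace (c i) :=
    (Module.End.eigenspaces_iSupIndep _).comp hc
  rw [← Submodule.Quotient.mk_eq_zero]
  refine (iSupIndep_iff_finsetSum_eq_zero_imp_eq_zero _).1 indep Finset.univ
    (fun j => N.mkQ (v j)) (fun j _ => ?_) ?_ i (Finset.mem_univ i)
  · rw [Module.End.mem_eigenspace_iff, Submodule.mkQ_apply, Submodule.mapQ_apply, hv,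
      Submodule.Quotient.mk_smul]
  · rwa [← map_sum, Submodule.mkQ_apply, Submodule.Quotient.mk_eq_zero]

theorem omega_nonempty [Infinite F] (Φ : Finset (Module.Dual F V)) : (Omega Φ).Nonempty := by
  classical
  obtain ⟨x, hx⟩ := Module.Dual.exists_forall_ne_zero_of_forall_exists
    (fun p : Φ.offDiag => p.1.1 - p.1.2) fun p => by
      have hne : p.1.1 - p.1.2 ≠ 0 := sub_ne_zero.2 (Finset.mem_offDiag.1 p.2).2.2
      contrapose! hne
      exact LinearMap.ext hne
  exact ⟨x, fun f hf g hg hfg h => hx ⟨(f, g), Finset.mem_offDiag.2 ⟨hf, hg, hfg⟩⟩ (by simp [h])⟩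

theorem omega_anti {Φ Ψ : Finset (Module.Dual F V)} (h : Φ ⊆ Ψ) : Omega Ψ ⊆ Omega Φ :=
  fun _ hv f hf g hg => hv f (h hf) g (h hg)

theorem apply_injective_of_mem_omega {Φ : Finset (Module.Dual F V)} {x : V} (hx : x ∈ Omega Φ)
    {wt : ι → Module.Dual F V} (hwt : Function.Injective wt) (hΦ : ∀ i, wt i ∈ Φ) :
    Function.Injective fun i => wt i x := fun i j hij => by
  by_contra hne
  exact hx _ (hΦ i) _ (hΦ j) (hwt.ne hne) hij

theorem injective_of_apply_eq_intCast [CharZero F] {wt : ι → Module.Dual F V} {x : V} {w : ι → ℤ}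
    (hw : ∀ i, wt i x = w i) (hinj : Function.Injective w) : Function.Injective wt :=
  fun i j h => hinj (Int.cast_injective (α := F) (by rw [← hw, ← hw, h]))

end Eigenvectors

section Generation

variable {F : Type*} [Field F] {n : ℕ}

/-- A subspace closed under the superbracket. It need not be compatible with the parity. -/
def BracketClosed (N : Submodule F (Module.End F (Grassmann F n))) : Prop :=
  ∀ a ∈ N, ∀ b ∈ N, superBracket a b ∈ N

theorem bracketClosed_span {s : Set (Module.End F (Grassmann F n))}
    (h : ∀ a ∈ s, ∀ b ∈ s, superBracket a b ∈ Submodule.span F s) :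
    BracketClosed (Submodule.span F s) := by
  intro a ha b hb
  rw [← superBracketₗ_apply]
  have := Submodule.apply_mem_map₂ superBracketₗ ha hb
  rw [Submodule.map₂_span_span] at this
  refine Submodule.span_le.2 ?_ this
  rintro _ ⟨x, hx, y, hy, rfl⟩
  simpa only [superBracketₗ_apply, SetLike.mem_coe] using h x hx y hy

theorem generated_le {X : Set (Module.End F (Grassmann F n))}
    {N : Submodule F (Module.End F (Grassmann F n))} (hX : X ⊆ N) (hN : BracketClosed N) :
    generated X ≤ N :=
  sInf_le ⟨hX, hN⟩

theorem subset_generated (X : Set (Module.End F (Grassmann F n))) :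
    X ⊆ (generated X : Set (Module.End F (Grassmann F n))) := fun x hx => by
  rw [generated, SetLike.mem_coe, Submodule.mem_sInf]
  exact fun N hN => hN.1 hx

theorem bracketClosed_generated (X : Set (Module.End F (Grassmann F n))) :
    BracketClosed (generated X) := by
  intro a ha b hb
  rw [generated, Submodule.mem_sInf] at *
  exact fun N hN => hN.2 a (ha N hN) b (hb N hN)

theorem generated_pair_eq {A B : Module.End F (Grassmann F n)}
    {L : Submodule F (Module.End F (Grassmann F n))} (hL : BracketClosed L) (hA : A ∈ L)
    (hB : B ∈ L) (le : ∀ N, BracketClosed N → A ∈ N → B ∈ N → L ≤ N) : generated {A, B} = L :=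
  le_antisymm (generated_le (Set.pair_subset hA hB) hL)
    (le _ (bracketClosed_generated _) (subset_generated _ (by simp)) (subset_generated _ (by simp)))

theorem mem_of_sum_weightVectors_mem {𝔥 N : Submodule F (Module.End F (Grassmann F n))}
    (hN : BracketClosed N) {ι : Type*} [Fintype ι] {wt : ι → Module.Dual F 𝔥}
    {v : ι → Module.End F (Grassmann F n)} {h : 𝔥}
    (hv : ∀ i, superBracket (h : Module.End F (Grassmann F n)) (v i) = wt i h • v i)
    (hwt : Function.Injective fun i => wt i h) (hh : (h : Module.End F (Grassmann F n)) ∈ N)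
    (hs : ∑ i, v i ∈ N) (i : ι) : v i ∈ N := by
  refine mem_of_sum_eigenvectors_mem (T := superBracketₗ (h : Module.End F (Grassmann F n)))
    (fun a ha => ?_) (fun i => ?_) hwt hs i
  · simpa only [Submodule.mem_comap, superBracketₗ_apply] using hN _ hh a ha
  · rw [superBracketₗ_apply, hv]

/-- The closure and inclusion properties, common to the four families, of a Lie superalgebra `L`
with local part `Lneg`, `L₀`, `Lt` and Cartan subalgebra `𝔥`. -/
structure CartanData (L Lneg L₀ Lt 𝔥 : Submodule F (Module.End F (Grassmann F n))) : Prop where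
  closed : BracketClosed L
  closed_zero : BracketClosed L₀
  neg_le : Lneg ≤ L
  zero_le : L₀ ≤ L
  top_le : Lt ≤ L
  cartan_le : 𝔥 ≤ L₀

theorem hasCartanGenerators_of [Infinite F] {r : ℕ}
    {L Lneg L₀ Lt 𝔥 : Submodule F (Module.End F (Grassmann F n))}
    (hdata : CartanData L Lneg L₀ Lt 𝔥) {κ : Type*} [Finite κ] {ρ : κ → Module.Dual F 𝔥}
    {e : κ → Module.End F (Grassmann F n)} {α : Module.Dual F 𝔥}
    {xneg : Module.End F (Grassmann F n)} {β : Fin r → Module.Dual F 𝔥}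
    {y : Fin r → Module.End F (Grassmann F n)} (hneg : IsWeightVector 𝔥 Lneg α xneg)
    (he : ∀ k, IsWeightVector 𝔥 L₀ (ρ k) (e k)) (hy : ∀ i, IsWeightVector 𝔥 Lt (β i) (y i))
    (hwt : Function.Injective (Sum.elim ρ (Sum.elim (fun _ : Unit => α) β)))
    (Φ₀ : Finset (Module.Dual F 𝔥))
    (gen₀ : ∀ h : 𝔥, h ∈ Omega Φ₀ → ∀ N, BracketClosed N →
      (h : Module.End F (Grassmann F n)) ∈ N → (∀ k, e k ∈ N) → L₀ ≤ N)
    (gen : ∀ N, BracketClosed N → L₀ ≤ N → xneg ∈ N → (∀ i, y i ∈ N) → L ≤ N) :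
    HasCartanGenerators r L Lneg L₀ Lt 𝔥 := by
  classical
  cases nonempty_fintype κ
  set wt := Sum.elim ρ (Sum.elim (fun _ : Unit => α) β)
  let v : κ ⊕ Unit ⊕ Fin r → Module.End F (Grassmann F n) :=
    Sum.elim e (Sum.elim (fun _ => xneg) y)
  have hv : ∀ (h : 𝔥) z, superBracket (h : Module.End F (Grassmann F n)) (v z) = wt z h • v z := by
    rintro h (k | _ | i)
    exacts [(he k).2.2 h, hneg.2.2 h, (hy i).2.2 h]
  have hx₀ : ∑ k, e k ∈ L₀ := Submodule.sum_mem _ fun k _ => (he k).1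
  refine ⟨α, β, xneg, ∑ k, e k, y, hneg, hx₀, hy,
    fun i => hwt.ne (a₁ := .inr (.inr i)) (a₂ := .inr (.inl ())) (by simp),
    hwt.comp (Sum.inr_injective.comp Sum.inr_injective), Φ₀ ∪ Finset.univ.image wt,
    omega_nonempty (V := 𝔥) _, fun h hh => ?_⟩
  have hh₀ : h ∈ Omega Φ₀ := omega_anti (V := 𝔥) Finset.subset_union_left hh
  have hsep : Function.Injective fun z => wt z h :=
    apply_injective_of_mem_omega (V := 𝔥) hh hwt fun z =>
      Finset.mem_union_right _ (Finset.mem_image_of_mem _ (Finset.mem_univ z))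
  have hhL₀ := hdata.cartan_le h.2
  refine ⟨generated_pair_eq hdata.closed_zero hx₀ hhL₀ fun N hN hxN hhN => gen₀ h hh₀ N hN hhN ?_,
    generated_pair_eq hdata.closed ?_ (hdata.zero_le hhL₀) fun N hN hxN hhN => ?_⟩
  · exact mem_of_sum_weightVectors_mem hN (fun k => hv h (.inl k)) (hsep.comp Sum.inl_injective)
      hhN hxN
  · exact add_mem (add_mem (hdata.neg_le hneg.1) (hdata.zero_le hx₀))
      (Submodule.sum_mem _ fun i _ => hdata.top_le (hy i).1)
  · have hxv : xneg + ∑ k, e k + ∑ i, y i = ∑ z, v z := by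
      simp only [v, Fintype.sum_sum_type, Sum.elim_inl, Sum.elim_inr, Fintype.sum_unique]
      abel
    have hmem := mem_of_sum_weightVectors_mem hN (hv h) hsep hhN (hxv ▸ hxN)
    exact gen N hN (gen₀ h hh₀ N hN hhN fun k => hmem (.inl k)) (hmem (.inr (.inl ())))
      fun i => hmem (.inr (.inr i))

end Generation

section RootVectors

variable {F : Type*} [Field F] {n : ℕ} {𝔥 V N : Submodule F (Module.End F (Grassmann F n))}

/-- The coordinates `c_i` of `∑ c_i ξ_i ∂/∂ξ_i` as linear functions on a subspace of diagonal
vector fields. -/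
def coordOn (𝔥 : Submodule F (Module.End F (Grassmann F n))) (i : Fin n) : Module.Dual F 𝔥 :=
  coord i ∘ₗ 𝔥.subtype

theorem coordOn_apply (i : Fin n) (h : 𝔥) :
    coordOn 𝔥 i h = coord i (h : Module.End F (Grassmann F n)) := rfl

theorem diag_coordOn (h𝔥 : 𝔥 ≤ cartanW F n) (h : 𝔥) :
    diag (fun i => coordOn 𝔥 i h) = (h : Module.End F (Grassmann F n)) :=
  diag_coord_of_mem_cartanW (h𝔥 h.2)

theorem mem_of_mono_mem {U : Submodule F (Grassmann F n)} (h : ∀ u, mono F u ∈ U)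
    (f : Grassmann F n) : f ∈ U := by
  suffices (⊤ : Submodule F (Grassmann F n)) ≤ U from this Submodule.mem_top
  rw [← span_mono, Submodule.span_le]
  exact Set.range_subset_iff.2 h

theorem fpd_mem_of_homog {k : ℕ} {i : Fin n}
    (h : ∀ u : Finset (Fin n), u.card = k → fpd F (mono F u) i ∈ V) {f : Grassmann F n}
    (hf : f ∈ homog F n k) : fpd F f i ∈ V :=
  homog_le (V := V.comap (fpdₗ i)) h hf

variable [NeZero (2 : F)]

theorem superBracket_fpd_of_eigenvector (h𝔥 : 𝔥 ≤ cartanW F n) (h : 𝔥) {f : Grassmann F n}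
    {γ : Module.Dual F 𝔥} (hf : diag (fun i => coordOn 𝔥 i h) f = γ h • f) (j : Fin n) :
    superBracket (h : Module.End F (Grassmann F n)) (fpd F f j) =
      (γ - coordOn 𝔥 j) h • fpd F f j := by
  rw [← diag_coordOn h𝔥 h, superBracket_diag_fpd, hf, fpd_smul, LinearMap.sub_apply, sub_smul_end]

theorem isWeightVector_fpd_mono (h𝔥 : 𝔥 ≤ cartanW F n) {u : Finset (Fin n)} {j : Fin n}
    (hV : fpd F (mono F u) j ∈ V) :
    IsWeightVector 𝔥 V (∑ i ∈ u, coordOn 𝔥 i - coordOn 𝔥 j) (fpd F (mono F u) j) :=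
  ⟨hV, fpd_ne_zero (mono_ne_zero u) j, fun h =>
    superBracket_fpd_of_eigenvector h𝔥 h (by rw [diag_mono, LinearMap.sum_apply]) j⟩

theorem isWeightVector_fpd_xi (h𝔥 : 𝔥 ≤ cartanW F n) {i j : Fin n} (hV : fpd F (xi F i) j ∈ V) :
    IsWeightVector 𝔥 V (coordOn 𝔥 i - coordOn 𝔥 j) (fpd F (xi F i) j) := by
  simpa using isWeightVector_fpd_mono (u := {i}) h𝔥 (by simpa using hV)

theorem isWeightVector_fpd_one (h𝔥 : 𝔥 ≤ cartanW F n) {j : Fin n} (hV : fpd F 1 j ∈ V) :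
    IsWeightVector 𝔥 V (-coordOn 𝔥 j) (fpd F 1 j) := by
  simpa using isWeightVector_fpd_mono (u := ∅) h𝔥 (by simpa using hV)

theorem fpd_mem_transfer (hN : BracketClosed N) {a j : Fin n} {f : Grassmann F n}
    (h : fpd F (xi F a) j ∈ N) (hf : fpd F f a ∈ N) (h₀ : xi F a * pd F j f = 0) :
    fpd F f j ∈ N := by
  have := hN _ h _ hf
  rw [superBracket_fpd_fpd, h₀] at this
  simpa [fpd_neg] using this

theorem fpd_one_mem_transfer (hN : BracketClosed N)
    (h : ∀ i j : Fin n, i ≠ j → fpd F (xi F i) j ∈ N) {a : Fin n} (ha : fpd F 1 a ∈ N)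
    (j : Fin n) : fpd F 1 j ∈ N := by
  by_cases haj : a = j
  · exact haj ▸ ha
  · exact fpd_mem_transfer hN (h a j haj) ha (by simp)

theorem fpd_mono_mem_transfer (hN : BracketClosed N)
    (h : ∀ i j : Fin n, i ≠ j → fpd F (xi F i) j ∈ N) {u : Finset (Fin n)} {a : Fin n}
    (ha : a ∈ u) (hf : fpd F (mono F u) a ∈ N) (j : Fin n) : fpd F (mono F u) j ∈ N := by
  by_cases haj : a = j
  · exact haj ▸ hf
  · exact fpd_mem_transfer hN (h a j haj) hf (xi_mul_pd_mono_of_ne haj ha)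

theorem fpd_xi_mem_of_star (hN : BracketClosed N) {a : Fin n}
    (hrow : ∀ j, j ≠ a → fpd F (xi F a) j ∈ N) (hcol : ∀ j, j ≠ a → fpd F (xi F j) a ∈ N)
    {i j : Fin n} (hij : i ≠ j) : fpd F (xi F i) j ∈ N := by
  by_cases hi : i = a
  · exact hi ▸ hrow j (hi ▸ hij.symm)
  by_cases hj : j = a
  · exact hj ▸ hcol i hi
  have := hN _ (hcol i hi) _ (hrow j hj)
  rw [superBracket_fpd_fpd] at this
  simpa [hij.symm] using this

theorem fpd_xi_sub_mem_of_star (hN : BracketClosed N) {a : Fin n}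
    (hrow : ∀ j, j ≠ a → fpd F (xi F a) j ∈ N) (hcol : ∀ j, j ≠ a → fpd F (xi F j) a ∈ N)
    (i j : Fin n) : fpd F (xi F i) i - fpd F (xi F j) j ∈ N := by
  have sub_center_mem : ∀ i, fpd F (xi F i) i - fpd F (xi F a) a ∈ N := fun i => by
    by_cases hi : i = a
    · simp [hi]
    have := hN _ (hcol i hi) _ (hrow i hi)
    rw [superBracket_fpd_fpd] at this
    simpa [fpd_neg, sub_eq_add_neg] using this
  simpa using sub_mem (sub_center_mem i) (sub_center_mem j)

end RootVectors

section DivergenceFree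

variable {F : Type*} [Field F] {n : ℕ}

/-- `Dij` as a linear map in the function. -/
def Dijₗ (i j : Fin n) : Grassmann F n →ₗ[F] Module.End F (Grassmann F n) :=
  fpdₗ j ∘ₗ pd F i + fpdₗ i ∘ₗ pd F j

theorem Dijₗ_apply (i j : Fin n) (f : Grassmann F n) : Dijₗ i j f = Dij F i j f := rfl

theorem Dij_comm (i j : Fin n) (f : Grassmann F n) : Dij F i j f = Dij F j i f := add_comm _ _

theorem Dij_xi_mul_xi (i j a b : Fin n) : Dij F i j (xi F a * xi F b) =
    fpd F ((if i = a then xi F b else 0) - (if i = b then xi F a else 0)) j +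
    fpd F ((if j = a then xi F b else 0) - (if j = b then xi F a else 0)) i := by
  simp [Dij, pd_xi_mul]

theorem Dij_mem_Sdeg {k : ℕ} {f : Grassmann F n} (hf : f ∈ homog F n k) (i j : Fin n) {d : ℤ}
    (hd : (k : ℤ) = d + 2) : Dij F i j f ∈ Sdeg F n d :=
  homog_le (V := (Sdeg F n d).comap (Dijₗ i j))
    (fun u hu => Submodule.subset_span ⟨u, i, j, by rw [hu, hd], rfl⟩) hf

theorem cartanS_le_Sdeg_zero : cartanS F n ≤ Sdeg F n 0 := by
  refine Submodule.span_le.2 ?_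
  rintro _ ⟨i, j, rfl⟩
  by_cases hij : i = j
  · simp [hij]
  · have := Dij_mem_Sdeg (xi_mul_xi_mem_homog (F := F) j i) i j (d := 0) rfl
    rw [Dij_xi_mul_xi] at this
    simpa [hij, Ne.symm hij, fpd_neg, add_comm, sub_eq_add_neg] using this

theorem Sdeg_zero_le {V : Submodule F (Module.End F (Grassmann F n))}
    (hroot : ∀ i j, i ≠ j → fpd F (xi F i) j ∈ V)
    (hdiag : ∀ i j, fpd F (xi F i) i - fpd F (xi F j) j ∈ V) : Sdeg F n 0 ≤ V := by
  refine Submodule.span_le.2 ?_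
  rintro _ ⟨u, i, j, hu, rfl⟩
  refine homog_two_le (V := V.comap (Dijₗ i j)) (fun p q _ => ?_)
    (mono_mem_homog (by exact_mod_cast hu))
  have half_mem : ∀ i j : Fin n, (if i = p then fpd F (xi F q) j else 0) -
      (if j = q then fpd F (xi F p) i else 0) ∈ V := fun i j => by
    split_ifs with hi hj hj
    · exact hi ▸ hj ▸ hdiag j i
    · simpa using hroot q j (Ne.symm hj)
    · simpa using hroot p i (Ne.symm hi)
    · simp
  rw [Submodule.mem_comap, Dijₗ_apply, Dij_xi_mul_xi]
  convert add_mem (half_mem i j) (half_mem j i) using 1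
  split_ifs <;> simp [fpd_neg, fpd_sub] <;> abel

theorem cartanS_le_cartanW : cartanS F n ≤ cartanW F n :=
  Submodule.span_le.2 (by
    rintro _ ⟨i, j, rfl⟩
    exact sub_mem (Submodule.subset_span ⟨i, rfl⟩) (Submodule.subset_span ⟨j, rfl⟩))

theorem diag_mem_cartanS {c : Fin n → F} (hc : ∑ i, c i = 0) : diag c ∈ cartanS F n := by
  rcases isEmpty_or_nonempty (Fin n) with _ | ⟨⟨a⟩⟩
  · simp [diag_apply]
  · have : diag c = ∑ i, c i • (fpd F (xi F i) i - fpd F (xi F a) a) := by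
      simp only [smul_sub, Finset.sum_sub_distrib, ← Finset.sum_smul, hc, zero_smul, sub_zero,
        diag_apply]
    rw [this]
    exact Submodule.sum_mem _ fun i _ =>
      Submodule.smul_mem _ _ (Submodule.subset_span ⟨i, a, rfl⟩)

theorem sum_coordOn_cartanS : ∑ i, coordOn (cartanS F n) i = 0 := by
  have : cartanS F n ≤ LinearMap.ker (∑ i, coord (F := F) i) := by
    refine Submodule.span_le.2 ?_
    rintro _ ⟨i, j, rfl⟩
    simp [LinearMap.sum_apply, coord_fpd_xi]
  ext h
  simpa [LinearMap.sum_apply, coordOn_apply] using this h.2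

variable [NeZero (2 : F)]

theorem fpd_mem_Sdeg {u : Finset (Fin n)} {j : Fin n} (hj : j ∉ u) {d : ℤ}
    (hd : (u.card : ℤ) = d + 1) : fpd F (mono F u) j ∈ Sdeg F n d := by
  have hD : Dij F j j (mono F (insert j u)) ∈ Sdeg F n d :=
    Dij_mem_Sdeg (mono_mem_homog (Finset.card_insert_of_notMem hj)) j j (by push_cast; omega)
  have : (2 : F) • fpd F (mono F u) j ∈ Sdeg F n d := by
    rcases pd_mono_of_mem (F := F) (Finset.mem_insert_self j u) with h | h <;>
      rw [Dij, h, Finset.erase_insert hj, ← two_smul F] at hD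
    · exact hD
    · rwa [fpd_neg, smul_neg, neg_mem_iff] at hD
  exact (Submodule.smul_mem_iff _ two_ne_zero).1 this

theorem fpd_xi_mem_Sdeg_zero {i j : Fin n} (hij : i ≠ j) : fpd F (xi F i) j ∈ Sdeg F n 0 := by
  simpa using fpd_mem_Sdeg (F := F) (u := {i}) (j := j) (by simpa using hij.symm) (d := 0)
    (by simp)

theorem superBracket_Dij_Dij (a b c d : Fin n) (f g : Grassmann F n) :
    superBracket (Dij F a b f) (Dij F c d g) =
      Dij F a c (parity F n (pd F b f) * pd F d g) + Dij F a d (parity F n (pd F b f) * pd F c g) +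
      Dij F b c (parity F n (pd F a f) * pd F d g) +
      Dij F b d (parity F n (pd F a f) * pd F c g) := by
  simp only [Dij, superBracket_add_left, superBracket_add_right, superBracket_fpd_fpd, pd_mul,
    parity_parity, fpd_add, pd_parity, fpd_neg, neg_mul]
  rw [pd_pd d c g, pd_pd b a f]
  simp only [map_neg, neg_mul, mul_neg, fpd_neg]
  abel

theorem superBracket_Dij_mem {N : Submodule F (Module.End F (Grassmann F n))} {k l d : ℕ}
    (hN : ∀ f ∈ homog F n d, ∀ i j, Dij F i j f ∈ N) (hd : k + l = d) {f g : Grassmann F n}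
    (hf : f ∈ homog F n (k + 1)) (hg : g ∈ homog F n (l + 1)) (a b i j : Fin n) :
    superBracket (Dij F a b f) (Dij F i j g) ∈ N := by
  have hmul : ∀ p q r s, Dij F r s (parity F n (pd F p f) * pd F q g) ∈ N := fun p q r s =>
    hN _ (hd ▸ mul_mem_homog (parity_mem_homog (pd_mem_homog hf p)) (pd_mem_homog hg q)) r s
  rw [superBracket_Dij_Dij]
  exact add_mem (add_mem (add_mem (hmul _ _ _ _) (hmul _ _ _ _)) (hmul _ _ _ _)) (hmul _ _ _ _)

theorem bracketClosed_Sdeg_zero : BracketClosed (Sdeg F n 0) := by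
  refine bracketClosed_span ?_
  rintro _ ⟨u, i, j, hu, rfl⟩ _ ⟨v, k, l, hv, rfl⟩
  exact superBracket_Dij_mem (k := 1) (l := 1) (fun f hf i j => Dij_mem_Sdeg hf i j rfl) rfl
    (mono_mem_homog (by exact_mod_cast hu)) (mono_mem_homog (by exact_mod_cast hv)) i j k l

theorem superBracket_fpd_one_Dij (l i j : Fin n) (f : Grassmann F n) :
    superBracket (fpd F 1 l) (Dij F i j f) = -Dij F i j (pd F l f) := by
  simp only [Dij, superBracket_add_right, superBracket_fpd_fpd, parity_one, pd_one, zero_mul,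
    fpd_zero, add_zero, one_mul, pd_pd l, fpd_neg, neg_add]

theorem superBracket_fpd_xi_Dij {a b : Fin n} {f : Grassmann F n} (hf : xi F a * pd F b f = 0)
    (i j : Fin n) : superBracket (fpd F (xi F a) b) (Dij F i j f) =
      -(if i = a then Dij F b j f else 0) - (if j = a then Dij F i b f else 0) := by
  have xi_mul_pd_pd : ∀ k, xi F a * pd F b (pd F k f) = -(if k = a then pd F b f else 0) :=
    fun k => by
      have := congrArg (pd F k) hf
      rw [pd_xi_mul, map_zero, sub_eq_zero] at this
      rw [pd_pd, mul_neg, ← this]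
  simp only [Dij, superBracket_add_right, superBracket_fpd_fpd, xi_mul_pd_pd, parity_xi, map_neg,
    pd_xi]
  split_ifs <;> simp [fpd_neg] <;> abel

theorem Dij_univ_mem {N : Submodule F (Module.End F (Grassmann F n))} (hN : BracketClosed N)
    (hroot : ∀ i j : Fin n, i ≠ j → fpd F (xi F i) j ∈ N) {a : Fin n}
    (ha : Dij F a a (mono F Finset.univ) ∈ N) (i j : Fin n) :
    Dij F i j (mono F Finset.univ) ∈ N := by
  have xi_mul_pd : ∀ b, a ≠ b → xi F a * pd F b (mono F Finset.univ) = 0 := fun b hb =>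
    xi_mul_pd_mono_of_ne hb (Finset.mem_univ a)
  have row_mem : ∀ b, Dij F a b (mono F Finset.univ) ∈ N := fun b => by
    by_cases hb : a = b
    · exact hb ▸ ha
    have := hN _ (hroot a b hb) _ ha
    rw [superBracket_fpd_xi_Dij (xi_mul_pd b hb), if_pos rfl, if_pos rfl, Dij_comm b a,
      ← neg_add', ← two_smul F] at this
    exact (Submodule.smul_mem_iff _ two_ne_zero).1 (neg_mem_iff.1 this)
  by_cases hi : a = i
  · exact hi ▸ row_mem j
  by_cases hj : a = j
  · exact hj ▸ Dij_comm (F := F) _ _ _ ▸ row_mem i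
  have := hN _ (hroot a i hi) _ (row_mem j)
  rw [superBracket_fpd_xi_Dij (xi_mul_pd i hi), if_pos rfl, if_neg (Ne.symm hj)] at this
  simpa using this

end DivergenceFree

section Star

variable {n : ℕ}

/-- The sum of the indices of `Fin n`. -/
def indexSum (n : ℕ) : ℤ := ∑ j : Fin n, (j.val : ℤ)

theorem three_le_indexSum (hn : 3 ≤ n) : 3 ≤ indexSum n := by
  obtain ⟨k, rfl⟩ := Nat.exists_eq_add_of_le' hn
  have : 0 ≤ ∑ i : Fin k, ((i.succ.succ.succ).val : ℤ) :=
    Finset.sum_nonneg fun _ _ => Int.natCast_nonneg _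
  simp only [indexSum, Fin.sum_univ_succ, Fin.val_zero, Fin.val_succ] at *
  push_cast at *
  omega

variable [NeZero n]

/-- The diagonal entries of a traceless matrix on which the roots `±(ε_0 - ε_j)` of `gl(n)` take
distinct values, all of which are large. -/
def sepDiag (i : Fin n) : ℤ := if i = 0 then -indexSum n else i.val

theorem sum_sepDiag : ∑ i, sepDiag (n := n) i = 0 := by
  obtain ⟨k, rfl⟩ := Nat.exists_eq_succ_of_ne_zero (NeZero.ne n)
  simp [sepDiag, indexSum, Fin.sum_univ_succ]

variable (n) in
/-- The pairs `(i, j)` for which `ξ_i ∂/∂ξ_j` is a root vector in the row or in the column of the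
index `0`. -/
def StarRoot : Type := {p : Fin n × Fin n // p.1 ≠ p.2 ∧ (p.1 = 0 ∨ p.2 = 0)}

instance : Finite (StarRoot n) := inferInstanceAs (Finite {_p : Fin n × Fin n // _})

/-- The value of the root of `ξ_i ∂/∂ξ_j` at the matrix with diagonal `sepDiag`. -/
def StarRoot.value (p : StarRoot n) : ℤ := sepDiag p.1.1 - sepDiag p.1.2

theorem StarRoot.value_eq (p : StarRoot n) :
    (p.1.1 = 0 ∧ 0 < p.1.2.val ∧ p.value = -indexSum n - p.1.2.val) ∨
      (p.1.2 = 0 ∧ 0 < p.1.1.val ∧ p.value = p.1.1.val + indexSum n) := by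
  rcases p.2.2 with h | h
  · have hne : p.1.2 ≠ 0 := fun h' => p.2.1 (h.trans h'.symm)
    exact .inl ⟨h, Fin.pos_iff_ne_zero.2 hne, by simp [value, sepDiag, h, hne]⟩
  · have hne : p.1.1 ≠ 0 := fun h' => p.2.1 (h'.trans h.symm)
    exact .inr ⟨h, Fin.pos_iff_ne_zero.2 hne, by simp [value, sepDiag, h, hne]⟩

theorem StarRoot.value_injective (hn : 3 ≤ n) : Function.Injective (StarRoot.value (n := n)) := by
  intro p q hpq
  have := three_le_indexSum hn
  rcases p.value_eq with ⟨hp, _, hp'⟩ | ⟨hp, _, hp'⟩ <;>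
    rcases q.value_eq with ⟨hq, _, hq'⟩ | ⟨hq, _, hq'⟩
  · exact Subtype.ext (Prod.ext (hp.trans hq.symm) (Fin.ext (by omega)))
  · omega
  · omega
  · exact Subtype.ext (Prod.ext (Fin.ext (by omega)) (hp.trans hq.symm))

theorem StarRoot.lt_abs_value (hn : 3 ≤ n) (p : StarRoot n) : 3 < |p.value| := by
  have := three_le_indexSum hn
  rw [lt_abs]
  rcases p.value_eq with ⟨_, _, _⟩ | ⟨_, _, _⟩ <;> omega

variable {F : Type*} [Field F]

variable (n F) in
/-- The diagonal vector field with entries `sepDiag`. -/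
def sepField : Module.End F (Grassmann F n) := diag fun i => (sepDiag i : F)

theorem coordOn_sepField {𝔥 : Submodule F (Module.End F (Grassmann F n))} (hs : sepField n F ∈ 𝔥)
    (i : Fin n) : coordOn 𝔥 i ⟨sepField n F, hs⟩ = sepDiag i :=
  coord_diag _ _

theorem sum_coordOn_sepField {𝔥 : Submodule F (Module.End F (Grassmann F n))}
    (hs : sepField n F ∈ 𝔥) : ∑ i, coordOn 𝔥 i ⟨sepField n F, hs⟩ = 0 := by
  simp_rw [coordOn_sepField, ← Int.cast_sum, sum_sepDiag, Int.cast_zero]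

theorem sepField_mem_cartanS : sepField n F ∈ cartanS F n :=
  diag_mem_cartanS (by rw [← Int.cast_sum, sum_sepDiag, Int.cast_zero])

theorem Sdeg_zero_le_of_star [NeZero (2 : F)] {N : Submodule F (Module.End F (Grassmann F n))}
    (hN : BracketClosed N) (hstar : ∀ p : StarRoot n, fpd F (xi F p.1.1) p.1.2 ∈ N) :
    Sdeg F n 0 ≤ N := by
  have row_mem : ∀ j, j ≠ 0 → fpd F (xi F 0) j ∈ N := fun j hj =>
    hstar ⟨(0, j), hj.symm, .inl rfl⟩
  have col_mem : ∀ j, j ≠ 0 → fpd F (xi F j) 0 ∈ N := fun j hj => hstar ⟨(j, 0), hj, .inr rfl⟩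
  exact Sdeg_zero_le (fun _ _ => fpd_xi_mem_of_star hN row_mem col_mem)
    (fpd_xi_sub_mem_of_star hN row_mem col_mem)

theorem hasCartanGenerators_of_star [CharZero F] (hn : 3 ≤ n)
    {L Lneg L₀ Lt 𝔥 : Submodule F (Module.End F (Grassmann F n))}
    (hdata : CartanData L Lneg L₀ Lt 𝔥) (h𝔥 : 𝔥 ≤ cartanW F n) (hS : Sdeg F n 0 ≤ L₀)
    {α β : Module.Dual F 𝔥} {x y : Module.End F (Grassmann F n)}
    (hx : IsWeightVector 𝔥 Lneg α x) (hy : IsWeightVector 𝔥 Lt β y) (hs : sepField n F ∈ 𝔥)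
    {a b : ℤ} (hα : α ⟨_, hs⟩ = a) (hβ : β ⟨_, hs⟩ = b) (ha : |a| ≤ 3) (hb : |b| ≤ 3)
    (hab : a ≠ b) (Φ₀ : Finset (Module.Dual F 𝔥))
    (gen₀ : ∀ h : 𝔥, h ∈ Omega Φ₀ → ∀ N, BracketClosed N →
      (h : Module.End F (Grassmann F n)) ∈ N → Sdeg F n 0 ≤ N → L₀ ≤ N)
    (gen : ∀ N, BracketClosed N → L₀ ≤ N → x ∈ N → y ∈ N → L ≤ N) :
    HasCartanGenerators 1 L Lneg L₀ Lt 𝔥 := by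
  have value_ne : ∀ p : StarRoot n, ∀ c : ℤ, |c| ≤ 3 → p.value ≠ c := fun p c hc h =>
    (hc.trans_lt (h ▸ p.lt_abs_value hn)).false
  refine hasCartanGenerators_of hdata (ρ := fun p : StarRoot n => coordOn 𝔥 p.1.1 - coordOn 𝔥 p.1.2)
    (e := fun p => fpd F (xi F p.1.1) p.1.2) (β := fun _ => β) (y := fun _ => y) hx
    (fun p => isWeightVector_fpd_xi h𝔥 (hS (fpd_xi_mem_Sdeg_zero p.2.1))) (fun _ => hy)
    (injective_of_apply_eq_intCast (V := 𝔥) (x := ⟨_, hs⟩)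
      (w := Sum.elim StarRoot.value (Sum.elim (fun _ : Unit => a) fun _ => b)) ?_ ?_) Φ₀
    (fun h hΦ N hN hh hstar => gen₀ h hΦ N hN hh (Sdeg_zero_le_of_star hN hstar))
    fun N hN h₀ hxN hyN => gen N hN h₀ hxN (hyN 0)
  · rintro (p | _ | _)
    · simp [coordOn_sepField, StarRoot.value]
    · exact hα
    · exact hβ
  · refine (StarRoot.value_injective hn).sumElim ((Function.injective_of_subsingleton _).sumElim
      (Function.injective_of_subsingleton _) fun _ _ => hab) ?_
    rintro p (_ | _)
    exacts [value_ne p a ha, value_ne p b hb]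

end Star

section TypeW

variable {F : Type*} [Field F] {n : ℕ}

theorem fpd_mem_Wdeg {k : ℕ} {f : Grassmann F n} (hf : f ∈ homog F n k) (i : Fin n) {d : ℤ}
    (hd : (k : ℤ) = d + 1) : fpd F f i ∈ Wdeg F n d :=
  fpd_mem_of_homog (V := Wdeg F n d)
    (fun u hu => Submodule.subset_span ⟨u, i, by rw [hu, hd], rfl⟩) hf

theorem cartanW_le_Wdeg_zero : cartanW F n ≤ Wdeg F n 0 := by
  refine Submodule.span_le.2 ?_
  rintro _ ⟨i, rfl⟩
  exact fpd_mem_Wdeg (xi_mem_homog i) i rfl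

theorem Sdeg_zero_le_Wdeg_zero : Sdeg F n 0 ≤ Wdeg F n 0 :=
  Sdeg_zero_le (fun i j _ => fpd_mem_Wdeg (xi_mem_homog i) j rfl) fun i j =>
    sub_mem (fpd_mem_Wdeg (xi_mem_homog i) i rfl) (fpd_mem_Wdeg (xi_mem_homog j) j rfl)

variable (F n) in
/-- The trace of a diagonal vector field. -/
def diagTrace : Module.Dual F (cartanW F n) := ∑ i, coordOn (cartanW F n) i

theorem diagTrace_ne_zero [NeZero n] : diagTrace F n ≠ 0 := fun h => by
  have := LinearMap.congr_fun h ⟨_, diag_mem_cartanW (Pi.single 0 1)⟩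
  simp [diagTrace, LinearMap.sum_apply, coordOn_apply] at this

theorem eq_sum_add_diagTrace_smul (h : cartanW F n) (a : Fin n) :
    (h : Module.End F (Grassmann F n)) =
      ∑ i, coordOn _ i h • (fpd F (xi F i) i - fpd F (xi F a) a) +
        diagTrace F n h • fpd F (xi F a) a := by
  conv_lhs => rw [← diag_coordOn le_rfl h, diag_apply]
  simp only [smul_sub, Finset.sum_sub_distrib, diagTrace, LinearMap.sum_apply, Finset.sum_smul]
  abel

variable [NeZero (2 : F)]

theorem fpd_mem_superDer {p : ZMod 2} {f : Grassmann F n} (hf : f ∈ part F n (p + 1))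
    (i : Fin n) : fpd F f i ∈ superDer F n p := by
  rw [mem_part_iff, neg_one_pow_val_add, val_one_zmod_two] at hf
  constructor
  · intro q a ha
    rw [mem_part_iff] at ha ⊢
    have hpd : parity F n (pd F i a) = -((-1 : F) ^ q.val • pd F i a) := by
      rw [← map_smul, ← ha, pd_parity, neg_neg]
    rw [fpd_apply, parity_mul, hf, neg_one_pow_val_add, hpd]
    simp [smul_smul, mul_comm]
  · intro q a ha b
    rw [fpd_apply, fpd_apply, fpd_apply, pd_mul, mul_add, ← mul_assoc, ← mul_assoc]
    congr 1
    obtain rfl | rfl := zmod_two_eq_zero_or_one p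
    · rw [mul_eq_parity_mul_of_parity_eq_neg (a := f) (by simpa using hf), parity_parity]
      simp [mul_assoc]
    · rw [mul_eq_mul_of_parity_eq_self (a := f) (by simpa using hf), parity_of_mem_part ha]
      simp [mul_assoc]

theorem eq_sum_fpd_of_mem_superDer {p : ZMod 2} {D : Module.End F (Grassmann F n)}
    (hD : D ∈ superDer F n p) : D = ∑ i, fpd F (D (xi F i)) i := by
  obtain ⟨D_mem, D_mul⟩ := hD
  refine LinearMap.ext fun a => ?_
  induction a using grassmann_induction with
  | one =>
    have := D_mul 0 1 (mem_part_iff.2 (by simp)) 1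
    simp only [mul_one, mul_zero, ZMod.val_zero, pow_zero, one_smul, one_mul, left_eq_add] at this
    simp [LinearMap.sum_apply, fpd_apply, this]
  | add a b ha hb => rw [map_add, map_add, ha, hb]
  | smul c a ha => rw [map_smul, map_smul, ha]
  | xi_mul j a ha =>
    have fpd_xi_mul : ∀ i, fpd F (D (xi F i)) i (xi F j * a) =
        (if i = j then D (xi F i) * a else 0) +
          (-1 : F) ^ (p * 1).val • (xi F j * fpd F (D (xi F i)) i a) := fun i => by
      have := parity_of_mem_part (D_mem 1 _ (xi_mem_part i))
      rw [neg_one_pow_val_add, val_one_zmod_two] at this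
      rw [fpd_apply, fpd_apply, pd_xi_mul, mul_sub, ← mul_assoc (D (xi F i)), mul_xi, this]
      split_ifs <;> simp [mul_assoc]
    rw [D_mul 1 _ (xi_mem_part j), ha, LinearMap.sum_apply, LinearMap.sum_apply, Finset.mul_sum,
      Finset.smul_sum]
    simp only [fpd_xi_mul, Finset.sum_add_distrib, Finset.sum_ite_eq', Finset.mem_univ, if_true]

theorem fpd_mem_W (f : Grassmann F n) (i : Fin n) : fpd F f i ∈ W F n := by
  refine mem_of_mono_mem (U := (W F n).comap (fpdₗ i)) (fun u => ?_) f
  have : mono F u ∈ part F n ((u.card + 1 : ZMod 2) + 1) := by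
    rw [add_assoc, CharTwo.add_self_eq_zero, add_zero]
    exact mem_part_of_mem_homog (mono_mem_homog rfl)
  exact Submodule.mem_iSup_of_mem (p := superDer F n) _ (fpd_mem_superDer this i)

theorem W_le {N : Submodule F (Module.End F (Grassmann F n))}
    (h : ∀ (u : Finset (Fin n)) i, fpd F (mono F u) i ∈ N) : W F n ≤ N :=
  iSup_le fun p D hD => by
    rw [eq_sum_fpd_of_mem_superDer hD]
    exact Submodule.sum_mem _ fun i _ =>
      mem_of_mono_mem (U := N.comap (fpdₗ i)) (fun u => h u i) _

theorem W_eq_span : W F n =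
    Submodule.span F {D | ∃ (u : Finset (Fin n)) (i : Fin n), D = fpd F (mono F u) i} :=
  le_antisymm (W_le fun u i => Submodule.subset_span ⟨u, i, rfl⟩)
    (Submodule.span_le.2 (by rintro _ ⟨u, i, rfl⟩; exact fpd_mem_W _ _))

theorem bracketClosed_W : BracketClosed (W F n) := by
  rw [W_eq_span]
  refine bracketClosed_span ?_
  rintro _ ⟨u, i, rfl⟩ _ ⟨v, j, rfl⟩
  rw [← W_eq_span, superBracket_fpd_fpd]
  exact add_mem (fpd_mem_W _ _) (fpd_mem_W _ _)

theorem Wdeg_le_W (d : ℤ) : Wdeg F n d ≤ W F n :=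
  Submodule.span_le.2 (by rintro _ ⟨u, i, -, rfl⟩; exact fpd_mem_W _ _)

theorem bracketClosed_Wdeg_zero : BracketClosed (Wdeg F n 0) := by
  refine bracketClosed_span ?_
  rintro _ ⟨u, i, hu, rfl⟩ _ ⟨v, j, hv, rfl⟩
  have hu' : mono F u ∈ homog F n (0 + 1) := mono_mem_homog (by exact_mod_cast hu)
  have hv' : mono F v ∈ homog F n (0 + 1) := mono_mem_homog (by exact_mod_cast hv)
  rw [superBracket_fpd_fpd]
  exact add_mem (fpd_mem_Wdeg (mul_mem_homog hu' (pd_mem_homog hv' i)) j (by simp))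
    (fpd_mem_Wdeg (mul_mem_homog (pd_mem_homog (parity_mem_homog hu') j) hv') i (by simp))

variable (F n) in
theorem cartanData_W (t : ℤ) :
    CartanData (W F n) (Wdeg F n (-1)) (Wdeg F n 0) (Wdeg F n t) (cartanW F n) where
  closed := bracketClosed_W
  closed_zero := bracketClosed_Wdeg_zero
  neg_le := Wdeg_le_W _
  zero_le := Wdeg_le_W _
  top_le := Wdeg_le_W _
  cartan_le := cartanW_le_Wdeg_zero

variable {N : Submodule F (Module.End F (Grassmann F n))}

theorem Wdeg_zero_le_of_diagTrace_ne_zero (hS : Sdeg F n 0 ≤ N) {h : cartanW F n}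
    (hh : (h : Module.End F (Grassmann F n)) ∈ N) (htr : diagTrace F n h ≠ 0) :
    Wdeg F n 0 ≤ N := by
  have sub_mem_N : ∀ i a, fpd F (xi F i) i - fpd F (xi F a) a ∈ N := fun i a =>
    hS (cartanS_le_Sdeg_zero (Submodule.subset_span ⟨i, a, rfl⟩))
  have diag_mem : ∀ a, fpd F (xi F a) a ∈ N := fun a => by
    rw [eq_sum_add_diagTrace_smul h a, Submodule.add_mem_iff_right _
      (Submodule.sum_mem _ fun i _ => Submodule.smul_mem _ _ (sub_mem_N i a))] at hh
    exact (Submodule.smul_mem_iff _ htr).1 hh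
  refine Submodule.span_le.2 ?_
  rintro _ ⟨u, j, hu, rfl⟩
  obtain ⟨i, rfl⟩ := Finset.card_eq_one.1 (show u.card = 1 by exact_mod_cast hu)
  rw [mono_singleton]
  by_cases hij : i = j
  · exact hij ▸ diag_mem i
  · exact hS (fpd_xi_mem_Sdeg_zero hij)

theorem W_le_of_bracketClosed (hN : BracketClosed N) (h₀ : Wdeg F n 0 ≤ N) {a b : Fin n}
    (ha : fpd F 1 a ∈ N) (hb : fpd F (mono F Finset.univ) b ∈ N) : W F n ≤ N := by
  have root_mem : ∀ i j : Fin n, i ≠ j → fpd F (xi F i) j ∈ N := fun i j _ =>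
    h₀ (fpd_mem_Wdeg (xi_mem_homog i) j rfl)
  refine W_le fun u j => mono_mem_of_univ (V := N.comap (fpdₗ j)) (d := 0) (fun l v _ hv => ?_)
    (fpd_mono_mem_transfer hN root_mem (Finset.mem_univ b) hb j) u (Nat.zero_le _)
  have := hN _ (fpd_one_mem_transfer hN root_mem ha l) _ hv
  simpa [fpdₗ_apply, superBracket_fpd_fpd] using this

end TypeW

theorem hasCartanGenerators_W (F : Type*) [Field F] [CharZero F] {n : ℕ} (hn : 3 ≤ n) :
    HasCartanGenerators 1 (W F n) (Wdeg F n (-1)) (Wdeg F n 0) (Wdeg F n (n - 1))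
      (cartanW F n) := by
  classical
  have : NeZero n := ⟨by omega⟩
  have hx : fpd F 1 ⟨1, by omega⟩ ∈ Wdeg F n (-1) :=
    fpd_mem_Wdeg (homog_zero (F := F) (n := n) ▸ Submodule.mem_span_singleton_self _) _ rfl
  have hy : fpd F (mono F Finset.univ) ⟨2, by omega⟩ ∈ Wdeg F n (n - 1) :=
    fpd_mem_Wdeg (mono_mem_homog (Finset.card_univ.trans (Fintype.card_fin n))) _ (by ring)
  refine hasCartanGenerators_of_star hn (cartanData_W F n _) le_rfl Sdeg_zero_le_Wdeg_zero
    (isWeightVector_fpd_one le_rfl hx) (isWeightVector_fpd_mono le_rfl hy)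
    (cartanS_le_cartanW sepField_mem_cartanS) (a := -1) (b := -2) ?_ ?_ (by simp) (by simp)
    (by simp) {0, diagTrace F n}
    (fun h hΦ N _ hh hS => Wdeg_zero_le_of_diagTrace_ne_zero hS hh <| by
      simpa using hΦ _ (by simp) 0 (by simp) diagTrace_ne_zero)
    fun N hN h₀ hx hy => W_le_of_bracketClosed hN h₀ hx hy
  · simp [coordOn_sepField, sepDiag]
  · rw [LinearMap.sub_apply, LinearMap.sum_apply, sum_coordOn_sepField]
    simp [coordOn_sepField, sepDiag]

section TypeS

variable {F : Type*} [Field F] {n : ℕ}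

theorem S_eq_span : S F n =
    Submodule.span F {D | ∃ (u : Finset (Fin n)) (i j : Fin n), D = Dij F i j (mono F u)} := by
  refine le_antisymm (iSup₂_le fun k _ => Submodule.span_mono ?_) (Submodule.span_le.2 ?_)
  · rintro _ ⟨u, i, j, -, rfl⟩
    exact ⟨u, i, j, rfl⟩
  · rintro _ ⟨u, i, j, rfl⟩
    rcases u.eq_empty_or_nonempty with rfl | hu
    · simp [Dij]
    · have card_le := u.card_le_univ
      have card_pos := hu.card_pos
      rw [Fintype.card_fin] at card_le
      refine Submodule.mem_iSup_of_mem (u.card - 2 : ℤ) (Submodule.mem_iSup_of_mem ?_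
        (Dij_mem_Sdeg (mono_mem_homog rfl) i j (by ring)))
      constructor <;> omega

theorem Dij_mem_S (i j : Fin n) (f : Grassmann F n) : Dij F i j f ∈ S F n :=
  mem_of_mono_mem (U := (S F n).comap (Dijₗ i j)) (fun u => by
    rw [S_eq_span]
    exact Submodule.subset_span ⟨u, i, j, rfl⟩) f

theorem Sdeg_le_S (d : ℤ) : Sdeg F n d ≤ S F n :=
  Submodule.span_le.2 (by rintro _ ⟨u, i, j, -, rfl⟩; exact Dij_mem_S _ _ _)

variable [NeZero (2 : F)]

theorem bracketClosed_S : BracketClosed (S F n) := by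
  rw [S_eq_span]
  refine bracketClosed_span ?_
  rintro _ ⟨u, i, j, rfl⟩ _ ⟨v, k, l, rfl⟩
  rw [← S_eq_span, superBracket_Dij_Dij]
  exact add_mem (add_mem (add_mem (Dij_mem_S _ _ _) (Dij_mem_S _ _ _)) (Dij_mem_S _ _ _))
    (Dij_mem_S _ _ _)

variable (F n) in
theorem cartanData_S (t : ℤ) :
    CartanData (S F n) (Sdeg F n (-1)) (Sdeg F n 0) (Sdeg F n t) (cartanS F n) where
  closed := bracketClosed_S
  closed_zero := bracketClosed_Sdeg_zero
  neg_le := Sdeg_le_S _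
  zero_le := Sdeg_le_S _
  top_le := Sdeg_le_S _
  cartan_le := cartanS_le_Sdeg_zero

theorem S_le_of_bracketClosed {N : Submodule F (Module.End F (Grassmann F n))}
    (hN : BracketClosed N) (h₀ : Sdeg F n 0 ≤ N) {a b : Fin n} (ha : fpd F 1 a ∈ N)
    (hb : fpd F (mono F (Finset.univ.erase b)) b ∈ N) : S F n ≤ N := by
  have root_mem : ∀ i j : Fin n, i ≠ j → fpd F (xi F i) j ∈ N := fun i j hij =>
    h₀ (fpd_xi_mem_Sdeg_zero hij)
  have hb' : Dij F b b (mono F Finset.univ) ∈ N := by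
    rcases pd_mono_of_mem (F := F) (Finset.mem_univ b) with h | h <;> rw [Dij, h]
    · exact add_mem hb hb
    · rw [fpd_neg]
      exact add_mem (neg_mem hb) (neg_mem hb)
  rw [S_eq_span, Submodule.span_le]
  rintro _ ⟨u, i, j, rfl⟩
  refine mono_mem_of_univ (V := N.comap (Dijₗ i j)) (d := 0) (fun l v _ hv => ?_)
    (Dij_univ_mem hN root_mem hb' i j) u (Nat.zero_le _)
  have := hN _ (fpd_one_mem_transfer hN root_mem ha l) _ hv
  rwa [Dijₗ_apply, superBracket_fpd_one_Dij, neg_mem_iff] at this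

end TypeS

theorem hasCartanGenerators_S (F : Type*) [Field F] [CharZero F] {n : ℕ} (hn : 4 ≤ n) :
    HasCartanGenerators 1 (S F n) (Sdeg F n (-1)) (Sdeg F n 0) (Sdeg F n (n - 2))
      (cartanS F n) := by
  have : NeZero n := ⟨by omega⟩
  have hx : fpd F 1 ⟨1, by omega⟩ ∈ Sdeg F n (-1) := by
    simpa using fpd_mem_Sdeg (F := F) (Finset.notMem_empty (⟨1, by omega⟩ : Fin n)) rfl
  have hy : fpd F (mono F (Finset.univ.erase ⟨1, by omega⟩)) ⟨1, by omega⟩ ∈ Sdeg F n (n - 2) :=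
    fpd_mem_Sdeg (Finset.notMem_erase _ _) (by
      rw [Finset.card_erase_of_mem (Finset.mem_univ _), Finset.card_univ, Fintype.card_fin]
      omega)
  refine hasCartanGenerators_of_star (by omega) (cartanData_S F n _) cartanS_le_cartanW le_rfl
    (isWeightVector_fpd_one cartanS_le_cartanW hx) (isWeightVector_fpd_mono cartanS_le_cartanW hy)
    sepField_mem_cartanS (a := -1) (b := -2) ?_ ?_ (by simp) (by simp) (by simp) ∅
    (fun _ _ _ _ _ h => h) fun N hN h₀ hx hy => S_le_of_bracketClosed hN h₀ hx hy
  · simp [coordOn_sepField, sepDiag]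
  · rw [LinearMap.sub_apply, LinearMap.sum_apply, Finset.sum_erase_eq_sub (Finset.mem_univ _),
      sum_coordOn_sepField]
    norm_num [coordOn_sepField, sepDiag]

section TypeStilde

theorem parity_conj_Dij {F : Type*} [Field F] [NeZero (2 : F)] {n k : ℕ} {f : Grassmann F n}
    (hf : f ∈ homog F n (k + 1)) (i j : Fin n) :
    parity F n * Dij F i j f * parity F n = (-1 : F) ^ (k + 1 : ZMod 2).val • Dij F i j f := by
  simp only [Dij, mul_add, add_mul, smul_add,
    parity_conj_fpd (mem_part_of_mem_homog (pd_mem_homog hf _))]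

variable {F : Type*} [Field F] {m : ℕ}

theorem parity_mono_univ : parity F (2 * m) (mono F Finset.univ) = mono F Finset.univ := by
  simp [parity_mono]

theorem mono_univ_mem_homog :
    mono F (Finset.univ : Finset (Fin (2 * m))) ∈ homog F (2 * m) (2 * m) :=
  mono_mem_homog (by simp)

theorem mono_univ_mul_pd_mono_univ (i : Fin (2 * m)) :
    mono F Finset.univ * pd F i (mono F Finset.univ) = 0 := by
  obtain ⟨k, hk⟩ := Nat.exists_eq_succ_of_ne_zero (Fin.pos i).ne'
  exact mul_eq_zero_of_mem_homog mono_univ_mem_homog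
    (pd_mem_homog (k := k) (mono_mem_homog (by simpa using hk)) i) (by omega)

theorem pd_mono_univ_mul_pd {k : ℕ} {f : Grassmann F (2 * m)} (hf : f ∈ homog F (2 * m) (k + 2))
    (i j : Fin (2 * m)) : pd F j (mono F Finset.univ) * pd F i f =
      -(mono F Finset.univ * pd F j (pd F i f)) := by
  have := congrArg (pd F j)
    (mul_eq_zero_of_mem_homog mono_univ_mem_homog (pd_mem_homog hf i) (by omega))
  rw [pd_mul, map_zero, parity_mono_univ] at this
  exact eq_neg_of_add_eq_zero_left this

theorem one_add_mono_univ_ne_zero [NeZero m] :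
    1 + mono F (Finset.univ : Finset (Fin (2 * m))) ≠ 0 := fun h => by
  have sq_eq_zero : mono F Finset.univ * mono F Finset.univ = (0 : Grassmann F (2 * m)) :=
    mul_eq_zero_of_mem_homog mono_univ_mem_homog mono_univ_mem_homog
      (by have := NeZero.ne m; omega)
  have := congrArg (mono F Finset.univ * ·) h
  simp only [mul_add, mul_one, sq_eq_zero, add_zero, mul_zero] at this
  exact mono_ne_zero _ this

theorem St_eq_span : St F m = Submodule.span F
    ({D | ∃ j : Fin (2 * m), D = fpd F (1 + mono F Finset.univ) j} ∪
      {D | ∃ (u : Finset (Fin (2 * m))) (i j : Fin (2 * m)), 2 ≤ u.card ∧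
        D = Dij F i j (mono F u)}) := by
  refine le_antisymm (iSup₂_le fun k hk => ?_) (Submodule.span_le.2 ?_)
  · rw [Stdeg]
    split_ifs with h
    · refine Submodule.span_mono ?_
      rintro _ ⟨j, rfl⟩
      exact .inl ⟨j, rfl⟩
    · refine Submodule.span_mono ?_
      rintro _ ⟨u, i, j, hu, rfl⟩
      have := hk.1
      exact .inr ⟨u, i, j, by omega, rfl⟩
  · rintro _ (⟨j, rfl⟩ | ⟨u, i, j, hu, rfl⟩)
    · have := j.2
      refine Submodule.mem_iSup_of_mem (-1) (Submodule.mem_iSup_of_mem ?_ ?_)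
      · constructor <;> omega
      · rw [Stdeg, if_pos rfl]
        exact Submodule.subset_span ⟨j, rfl⟩
    · have card_le := u.card_le_univ
      rw [Fintype.card_fin] at card_le
      refine Submodule.mem_iSup_of_mem (u.card - 2 : ℤ) (Submodule.mem_iSup_of_mem ?_ ?_)
      · constructor <;> omega
      · rw [Stdeg, if_neg (by omega)]
        exact Dij_mem_Sdeg (mono_mem_homog rfl) i j (by ring)

theorem fpd_one_add_mono_univ_mem_St (j : Fin (2 * m)) :
    fpd F (1 + mono F Finset.univ) j ∈ St F m := by
  rw [St_eq_span]
  exact Submodule.subset_span (.inl ⟨j, rfl⟩)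

theorem Dij_mem_St {k : ℕ} {f : Grassmann F (2 * m)} (hf : f ∈ homog F (2 * m) (k + 2))
    (i j : Fin (2 * m)) : Dij F i j f ∈ St F m :=
  homog_le (V := (St F m).comap (Dijₗ i j)) (fun u hu => by
    rw [Submodule.mem_comap, St_eq_span]
    exact Submodule.subset_span (.inr ⟨u, i, j, by omega, rfl⟩)) hf

theorem Stdeg_neg_one_le_St : Stdeg F m (-1) ≤ St F m := by
  rw [Stdeg, if_pos rfl, Submodule.span_le, Set.range_subset_iff]
  exact fpd_one_add_mono_univ_mem_St

theorem Sdeg_le_St {d : ℤ} (hd : 0 ≤ d) : Sdeg F (2 * m) d ≤ St F m := by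
  refine Submodule.span_le.2 ?_
  rintro _ ⟨u, i, j, hu, rfl⟩
  exact Dij_mem_St (k := u.card - 2) (mono_mem_homog (by omega)) i j

variable [NeZero (2 : F)]

theorem superBracket_fpd_one_add_mono_univ (i j : Fin (2 * m)) :
    superBracket (fpd F (1 + mono F Finset.univ) i) (fpd F (1 + mono F Finset.univ) j) =
      Dij F i j (mono F Finset.univ) := by
  have pd_mul_mono_univ :
      pd F j (mono F Finset.univ) * mono F Finset.univ = (0 : Grassmann F (2 * m)) := by
    have := congrArg (pd F j) (mul_eq_zero_of_mem_homog (mono_univ_mem_homog (F := F) (m := m))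
      mono_univ_mem_homog (by have := j.2; omega))
    rwa [pd_mul, parity_mono_univ, mono_univ_mul_pd_mono_univ, add_zero, map_zero] at this
  simp only [superBracket_fpd_fpd, map_add, parity_one, parity_mono_univ, pd_one, zero_add, add_mul,
    mul_add, one_mul, mul_one, mono_univ_mul_pd_mono_univ, pd_mul_mono_univ, add_zero, Dij]

theorem superBracket_fpd_one_add_mono_univ_Dij {k : ℕ} {f : Grassmann F (2 * m)}
    (hf : f ∈ homog F (2 * m) (k + 2)) (l i j : Fin (2 * m)) :
    superBracket (fpd F (1 + mono F Finset.univ) l) (Dij F i j f) =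
      fpd F ((1 + mono F Finset.univ) * pd F l (pd F i f)) j +
        fpd F ((1 + mono F Finset.univ) * pd F l (pd F j f)) i := by
  have cancel : fpd F (pd F j (mono F Finset.univ) * pd F i f) l +
      fpd F (pd F i (mono F Finset.univ) * pd F j f) l = 0 := by
    rw [pd_mono_univ_mul_pd hf, pd_mono_univ_mul_pd hf, pd_pd j i, ← fpd_add]
    simp
  simp only [Dij, superBracket_add_right, superBracket_fpd_fpd, map_add, parity_one,
    parity_mono_univ, pd_one, zero_add, add_add_add_comm, cancel, add_zero]

theorem superBracket_fpd_one_add_mono_univ_Dij_of_three_le {k : ℕ} {f : Grassmann F (2 * m)}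
    (hf : f ∈ homog F (2 * m) (k + 3)) (l i j : Fin (2 * m)) :
    superBracket (fpd F (1 + mono F Finset.univ) l) (Dij F i j f) = -Dij F i j (pd F l f) := by
  have mul_pd_pd : ∀ i, mono F Finset.univ * pd F l (pd F i f) = 0 := fun i =>
    mul_eq_zero_of_mem_homog mono_univ_mem_homog (pd_mem_homog (pd_mem_homog hf i) l) (by omega)
  rw [superBracket_fpd_one_add_mono_univ_Dij (k := k + 1) hf]
  simp only [add_mul, one_mul, mul_pd_pd, add_zero]
  rw [Dij, pd_pd l, pd_pd l, fpd_neg, fpd_neg, neg_add]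

theorem superBracket_fpd_one_add_mono_univ_Dij_mem_St {k : ℕ} {f : Grassmann F (2 * m)}
    (hf : f ∈ homog F (2 * m) (k + 2)) (l i j : Fin (2 * m)) :
    superBracket (fpd F (1 + mono F Finset.univ) l) (Dij F i j f) ∈ St F m := by
  cases k with
  | zero =>
    have mul_mem : ∀ g ∈ homog F (2 * m) 0, ∀ j, fpd F ((1 + mono F Finset.univ) * g) j ∈ St F m :=
      fun g hg j => by
        rw [homog_zero, Submodule.mem_span_singleton] at hg
        obtain ⟨c, rfl⟩ := hg
        rw [mul_smul_comm, mul_one, fpd_smul]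
        exact Submodule.smul_mem _ _ (fpd_one_add_mono_univ_mem_St j)
    rw [superBracket_fpd_one_add_mono_univ_Dij hf]
    exact add_mem (mul_mem _ (pd_mem_homog (pd_mem_homog hf i) l) j)
      (mul_mem _ (pd_mem_homog (pd_mem_homog hf j) l) i)
  | succ k =>
    rw [superBracket_fpd_one_add_mono_univ_Dij_of_three_le hf]
    exact neg_mem (Dij_mem_St (pd_mem_homog hf l) i j)

theorem bracketClosed_St : BracketClosed (St F m) := by
  have superBracket_mem : ∀ (u : Finset (Fin (2 * m))) (l i j : Fin (2 * m)), 2 ≤ u.card →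
      superBracket (fpd F (1 + mono F Finset.univ) l) (Dij F i j (mono F u)) ∈ St F m ∧
      superBracket (Dij F i j (mono F u)) (fpd F (1 + mono F Finset.univ) l) ∈ St F m := by
    intro u l i j hu
    obtain ⟨k, hk⟩ := Nat.exists_eq_add_of_le' hu
    have h := superBracket_fpd_one_add_mono_univ_Dij_mem_St (mono_mem_homog (F := F) hk) l i j
    have top_mem_part : 1 + mono F Finset.univ ∈ part F (2 * m) 0 :=
      mem_part_iff.2 (by simp [parity_mono_univ])
    exact ⟨h, superBracket_mem_of_swap_mem (parity_conj_fpd top_mem_part l)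
      (parity_conj_Dij (mono_mem_homog hk) i j) h⟩
  rw [St_eq_span]
  refine bracketClosed_span ?_
  rw [← St_eq_span]
  rintro _ (⟨l, rfl⟩ | ⟨u, i, j, hu, rfl⟩) _ (⟨l', rfl⟩ | ⟨v, i', j', hv, rfl⟩)
  · rw [superBracket_fpd_one_add_mono_univ]
    exact Dij_mem_St (k := 2 * m - 2) (mono_mem_homog (by have := l.2; simp; omega)) _ _
  · exact (superBracket_mem v l i' j' hv).1
  · exact (superBracket_mem u l' i j hu).2
  · obtain ⟨k, hk⟩ := Nat.exists_eq_add_of_le' hu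
    obtain ⟨k', hk'⟩ := Nat.exists_eq_add_of_le' hv
    exact superBracket_Dij_mem (k := k + 1) (l := k' + 1) (fun f hf => Dij_mem_St (k := k + k') hf)
      (by omega) (mono_mem_homog hk) (mono_mem_homog hk') _ _ _ _

variable (F m) in
theorem cartanData_St {t : ℤ} (ht : 0 ≤ t) : CartanData (St F m) (Stdeg F m (-1))
    (Sdeg F (2 * m) 0) (Sdeg F (2 * m) t) (cartanS F (2 * m)) where
  closed := bracketClosed_St
  closed_zero := bracketClosed_Sdeg_zero
  neg_le := Stdeg_neg_one_le_St
  zero_le := Sdeg_le_St le_rfl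
  top_le := Sdeg_le_St ht
  cartan_le := cartanS_le_Sdeg_zero

theorem isWeightVector_fpd_one_add_mono_univ (j : Fin (2 * m)) :
    IsWeightVector (cartanS F (2 * m)) (Stdeg F m (-1)) (0 - coordOn (cartanS F (2 * m)) j)
      (fpd F (1 + mono F Finset.univ) j) := by
  have : NeZero m := ⟨by have := j.2; omega⟩
  refine ⟨?_, fpd_ne_zero one_add_mono_univ_ne_zero j, fun h =>
    superBracket_fpd_of_eigenvector cartanS_le_cartanW h ?_ j⟩
  · rw [Stdeg, if_pos rfl]
    exact Submodule.subset_span ⟨j, rfl⟩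
  · have := LinearMap.congr_fun (sum_coordOn_cartanS (F := F) (n := 2 * m)) h
    rw [LinearMap.sum_apply] at this
    rw [map_add, diag_mono, this, ← mono_empty, diag_mono]
    simp

theorem St_le_of_bracketClosed {N : Submodule F (Module.End F (Grassmann F (2 * m)))}
    (hN : BracketClosed N) (h₀ : Sdeg F (2 * m) 0 ≤ N) {a : Fin (2 * m)}
    (ha : fpd F (1 + mono F Finset.univ) a ∈ N) : St F m ≤ N := by
  have fpd_mem : ∀ j, fpd F (1 + mono F Finset.univ) j ∈ N := fun j => by
    by_cases hj : a = j
    · exact hj ▸ ha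
    · refine fpd_mem_transfer hN (h₀ (fpd_xi_mem_Sdeg_zero hj)) ha ?_
      rw [map_add, pd_one, zero_add, xi_mul_pd_mono_of_ne hj (Finset.mem_univ _)]
  rw [St_eq_span, Submodule.span_le]
  rintro _ (⟨j, rfl⟩ | ⟨u, i, j, hu, rfl⟩)
  · exact fpd_mem j
  · refine mono_mem_of_univ (V := N.comap (Dijₗ i j)) (fun l v hv hvN => ?_) ?_ u hu
    · obtain ⟨k, hk⟩ := Nat.exists_eq_add_of_le' (Nat.succ_le_of_lt hv)
      have := hN _ (fpd_mem l) _ hvN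
      rwa [Dijₗ_apply, superBracket_fpd_one_add_mono_univ_Dij_of_three_le (mono_mem_homog hk),
        neg_mem_iff] at this
    · rw [Submodule.mem_comap, Dijₗ_apply, ← superBracket_fpd_one_add_mono_univ]
      exact hN _ (fpd_mem i) _ (fpd_mem j)

end TypeStilde

theorem hasCartanGenerators_St (F : Type*) [Field F] [CharZero F] {m : ℕ} (hm : 2 ≤ m) :
    HasCartanGenerators 1 (St F m) (Stdeg F m (-1)) (Stdeg F m 0) (Stdeg F m 1)
      (cartanS F (2 * m)) := by
  have : NeZero (2 * m) := ⟨by omega⟩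
  have hS₀ : Stdeg F m 0 = Sdeg F (2 * m) 0 := if_neg (by omega)
  have hS₁ : Stdeg F m 1 = Sdeg F (2 * m) 1 := if_neg (by omega)
  rw [hS₀, hS₁]
  have ne : (⟨1, by omega⟩ : Fin (2 * m)) ≠ ⟨2, by omega⟩ := by simp
  have hy : fpd F (mono F {⟨1, by omega⟩, ⟨2, by omega⟩}) ⟨3, by omega⟩ ∈ Sdeg F (2 * m) 1 :=
    fpd_mem_Sdeg (by simp) (by rw [Finset.card_pair ne]; rfl)
  refine hasCartanGenerators_of_star (by omega) (cartanData_St F m zero_le_one) cartanS_le_cartanW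
    le_rfl (isWeightVector_fpd_one_add_mono_univ ⟨1, by omega⟩)
    (isWeightVector_fpd_mono cartanS_le_cartanW hy) sepField_mem_cartanS (a := -1) (b := 0) ?_ ?_
    (by simp) (by simp) (by simp) ∅ (fun _ _ _ _ _ h => h)
    fun N hN h₀ hx _ => St_le_of_bracketClosed hN h₀ hx
  · simp [coordOn_sepField, sepDiag]
  · rw [Finset.sum_pair ne]
    norm_num [coordOn_sepField, sepDiag]

section Prime

variable {n : ℕ}

theorem prime_val (i : Fin n) :
    (prime i).val = if i.val < n / 2 then i.val + n / 2
      else if i.val < 2 * (n / 2) then i.val - n / 2 else i.val := by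
  unfold prime
  split_ifs <;> rfl

@[simp] theorem prime_prime (i : Fin n) : prime (prime i) = i := by
  have := i.2
  ext
  rw [prime_val, prime_val]
  split_ifs <;> omega

theorem prime_injective : Function.Injective (prime (n := n)) :=
  Function.LeftInverse.injective prime_prime

theorem prime_eq_iff {i j : Fin n} : prime i = j ↔ i = prime j :=
  ⟨fun h => by rw [← h, prime_prime], fun h => by rw [h, prime_prime]⟩

theorem sum_prime {M : Type*} [AddCommMonoid M] (f : Fin n → M) :
    ∑ i, f (prime i) = ∑ i, f i :=
  Equiv.sum_comp (Function.Involutive.toPerm prime prime_prime) f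

end Prime

section Poisson

variable {F : Type*} [Field F] {n : ℕ}

/-- The Hamiltonian vector field `∑_i ∂f/∂ξ_i ∂/∂ξ_{i'}` of `f ∈ Λ(n)`. It agrees with `DH` on
monomials up to the sign `(-1)^{|u|}`. -/
def ham : Grassmann F n →ₗ[F] Module.End F (Grassmann F n) :=
  ∑ i, fpdₗ (prime i) ∘ₗ pd F i

theorem ham_apply (f : Grassmann F n) : ham f = ∑ i, fpd F (pd F i f) (prime i) := by
  rw [ham, LinearMap.sum_apply]
  rfl

@[simp] theorem ham_one : ham (1 : Grassmann F n) = 0 := by simp [ham_apply]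

theorem ham_xi_mul_xi (i j : Fin n) :
    ham (xi F i * xi F j) = fpd F (xi F j) (prime i) - fpd F (xi F i) (prime j) := by
  simp only [ham_apply, pd_xi_mul, pd_xi, fpd_sub, Finset.sum_sub_distrib]
  congr 1
  · rw [Fintype.sum_eq_single i fun k hk => by simp [hk]]
    simp
  · rw [Fintype.sum_eq_single j fun k hk => by simp [hk]]
    simp

theorem ham_apply_xi_prime (f : Grassmann F n) (k : Fin n) :
    ham f (xi F (prime k)) = pd F k f := by
  rw [ham_apply, LinearMap.sum_apply, Fintype.sum_eq_single k fun i hi => by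
    simp [fpd_apply, prime_injective.ne hi]]
  simp [fpd_apply]

theorem ham_mono_ne_zero {u : Finset (Fin n)} (hu : u.Nonempty) : ham (mono F u) ≠ 0 := by
  obtain ⟨k, hk⟩ := hu
  intro h
  have hpd := ham_apply_xi_prime (mono F u) k
  rw [h, LinearMap.zero_apply] at hpd
  rcases pd_mono_of_mem (F := F) hk with h' | h' <;>
    simp [h', mono_ne_zero, eq_comm (a := (0 : Grassmann F n))] at hpd

/-- The Poisson bracket `∑_i (-1)^{|f|} ∂f/∂ξ_i ∂g/∂ξ_{i'}` of `Λ(n)`, with the sign for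
which `ham` carries it to the superbracket. -/
def poisson (f g : Grassmann F n) : Grassmann F n :=
  ∑ i, pd F i (parity F n f) * pd F (prime i) g

theorem superBracket_ham_ham [NeZero (2 : F)] (f g : Grassmann F n) :
    superBracket (ham f) (ham g) = ham (poisson f g) := by
  have pd_poisson_summand : ∀ i j,
      fpd F (pd F j (pd F i (parity F n f) * pd F (prime i) g)) (prime j) =
        fpd F (pd F i f * pd F (prime i) (pd F j g)) (prime j) +
          fpd F (pd F j (pd F i (parity F n f)) * pd F (prime i) g) (prime j) := by
    intro i j
    rw [pd_mul, pd_pd j (prime i), pd_parity i f, map_neg (parity F n), parity_parity, neg_mul_neg,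
      fpd_add, add_comm]
  have reindex :
      ∑ i, ∑ j, fpd F (pd F (prime j) (parity F n (pd F i f)) * pd F j g) (prime i) =
        ∑ i, ∑ j, fpd F (pd F j (pd F i (parity F n f)) * pd F (prime i) g) (prime j) := by
    rw [Finset.sum_comm (s := Finset.univ) (t := Finset.univ)
      (f := fun i j => fpd F (pd F j (pd F i (parity F n f)) * pd F (prime i) g) (prime j))]
    refine Finset.sum_congr rfl fun i _ => ?_
    rw [← sum_prime]
    refine Finset.sum_congr rfl fun j _ => ?_
    rw [prime_prime, pd_pd i j, pd_parity i f, map_neg, neg_neg]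
  rw [poisson, map_sum, ham_apply, ham_apply, superBracket_sum_left]
  simp only [superBracket_sum_right, superBracket_fpd_fpd, Finset.sum_add_distrib, ham_apply,
    pd_poisson_summand, reindex]

theorem poisson_mem_homog {k l : ℕ} {f g : Grassmann F n} (hf : f ∈ homog F n (k + 1))
    (hg : g ∈ homog F n (l + 1)) : poisson f g ∈ homog F n (k + l) :=
  Submodule.sum_mem _ fun i _ =>
    mul_mem_homog (pd_mem_homog (parity_mem_homog hf) i) (pd_mem_homog hg _)

theorem sum_pd_pd_prime [NeZero (2 : F)] (g : Grassmann F n) :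
    ∑ i, pd F i (pd F (prime i) g) = 0 := by
  have eq_neg : ∑ i, pd F i (pd F (prime i) g) = -∑ i, pd F i (pd F (prime i) g) := by
    conv_lhs => rw [← sum_prime]
    rw [← Finset.sum_neg_distrib]
    exact Finset.sum_congr rfl fun i _ => by rw [prime_prime, pd_pd]
  rw [eq_neg_iff_add_eq_zero, ← two_smul F] at eq_neg
  exact (smul_eq_zero_iff_right two_ne_zero).1 eq_neg

theorem poisson_eq_sum_pd [NeZero (2 : F)] (f g : Grassmann F n) :
    poisson f g = ∑ i, pd F i (parity F n f * pd F (prime i) g) := by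
  simp only [pd_mul, parity_parity, Finset.sum_add_distrib, ← Finset.mul_sum, sum_pd_pd_prime,
    mul_zero, add_zero, poisson]

variable (F n) in
/-- The span of the monomials other than `ξ_1 ⋯ ξ_n`. Its image under `ham` is `H(n)`. -/
def topFree : Submodule F (Grassmann F n) :=
  Submodule.span F {a | ∃ u : Finset (Fin n), u ≠ Finset.univ ∧ a = mono F u}

theorem pd_mem_topFree (i : Fin n) (f : Grassmann F n) : pd F i f ∈ topFree F n := by
  refine mem_of_mono_mem (U := (topFree F n).comap (pd F i)) (fun u => ?_) f
  rw [Submodule.mem_comap]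
  by_cases hi : i ∈ u
  · refine (mem_iff_of_eq_or_eq_neg (pd_mono_of_mem hi)).2 (Submodule.subset_span ⟨_, ?_, rfl⟩)
    exact fun h => Finset.notMem_erase i u (h ▸ Finset.mem_univ i)
  · rw [pd_mono_of_notMem hi]
    exact zero_mem _

theorem poisson_mem_topFree [NeZero (2 : F)] (f g : Grassmann F n) :
    poisson f g ∈ topFree F n := by
  rw [poisson_eq_sum_pd]
  exact Submodule.sum_mem _ fun i _ => pd_mem_topFree _ _

/-- A subspace of `Λ(n)` closed under the Poisson bracket. -/
def PoissonClosed (V : Submodule F (Grassmann F n)) : Prop :=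
  ∀ f ∈ V, ∀ g ∈ V, poisson f g ∈ V

theorem PoissonClosed.map [NeZero (2 : F)] {V : Submodule F (Grassmann F n)}
    (hV : PoissonClosed V) : BracketClosed (V.map ham) := by
  rintro _ ⟨f, hf, rfl⟩ _ ⟨g, hg, rfl⟩
  rw [superBracket_ham_ham]
  exact Submodule.mem_map_of_mem (hV f hf g hg)

theorem BracketClosed.comap [NeZero (2 : F)] {N : Submodule F (Module.End F (Grassmann F n))}
    (hN : BracketClosed N) : PoissonClosed (N.comap ham) := by
  intro f hf g hg
  rw [Submodule.mem_comap, ← superBracket_ham_ham]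
  exact hN _ hf _ hg

theorem DH_eq (u : Finset (Fin n)) : DH F u = (-1 : F) ^ u.card • ham (mono F u) := by
  rw [ham_apply]
  rfl

theorem DH_mem_iff {N : Submodule F (Module.End F (Grassmann F n))} {u : Finset (Fin n)} :
    DH F u ∈ N ↔ ham (mono F u) ∈ N := by
  rw [DH_eq]
  exact Submodule.smul_mem_iff _ (by simp)

theorem ham_mono_mem_Hdeg {u : Finset (Fin n)} {d : ℤ} (hd : (u.card : ℤ) = d + 2) :
    ham (mono F u) ∈ Hdeg F n d :=
  DH_mem_iff.1 (Submodule.subset_span ⟨u, hd, rfl⟩)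

theorem Hdeg_eq_map {d : ℤ} {k : ℕ} (hd : (k : ℤ) = d + 2) :
    Hdeg F n d = (homog F n k).map ham := by
  refine le_antisymm (Submodule.span_le.2 ?_) (Submodule.map_le_iff_le_comap.2 (homog_le ?_))
  · rintro _ ⟨u, hu, rfl⟩
    exact DH_mem_iff.2 (Submodule.mem_map_of_mem (mono_mem_homog (by omega)))
  · exact fun u hu => ham_mono_mem_Hdeg (by omega)

theorem Hdeg_le_H {d : ℤ} (h : -1 ≤ d) (h' : d ≤ n - 3) : Hdeg F n d ≤ H F n :=
  le_iSup₂_of_le d ⟨h, h'⟩ le_rfl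

theorem H_eq_map : H F n = (topFree F n).map ham := by
  refine le_antisymm (iSup₂_le fun k hk => Submodule.span_le.2 ?_)
    (Submodule.map_le_iff_le_comap.2 (Submodule.span_le.2 ?_))
  · rintro _ ⟨u, hu, rfl⟩
    refine DH_mem_iff.2 (Submodule.mem_map_of_mem (Submodule.subset_span ⟨u, ?_, rfl⟩))
    rintro rfl
    have := hk.2
    rw [Finset.card_univ, Fintype.card_fin] at hu
    omega
  · rintro _ ⟨u, hu, rfl⟩
    rw [SetLike.mem_coe, Submodule.mem_comap]
    rcases u.eq_empty_or_nonempty with rfl | hne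
    · rw [mono_empty, ham_one]
      exact zero_mem _
    · have card_pos := hne.card_pos
      have card_lt := (Finset.card_lt_iff_ne_univ u).2 hu
      rw [Fintype.card_fin] at card_lt
      exact Hdeg_le_H (d := u.card - 2) (by omega) (by omega) (ham_mono_mem_Hdeg (by ring))

end Poisson

section CartanH

variable {F : Type*} [Field F] {n : ℕ}

theorem cartanH_le_cartanW : cartanH F n ≤ cartanW F n :=
  Submodule.span_le.2 (by
    rintro _ ⟨i, -, rfl⟩
    exact sub_mem (Submodule.subset_span ⟨i, rfl⟩) (Submodule.subset_span ⟨prime i, rfl⟩))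

theorem cartanH_le_Hdeg_zero : cartanH F n ≤ Hdeg F n 0 := by
  rw [Hdeg_eq_map (k := 2) rfl]
  refine Submodule.span_le.2 ?_
  rintro _ ⟨i, -, rfl⟩
  exact ⟨xi F (prime i) * xi F i, xi_mul_xi_mem_homog _ _, by rw [ham_xi_mul_xi, prime_prime]⟩

variable (F n) in
theorem cartanData_H [NeZero (2 : F)] {t : ℤ} (ht : -1 ≤ t) (htn : t ≤ n - 3) (hn : 3 ≤ n) :
    CartanData (H F n) (Hdeg F n (-1)) (Hdeg F n 0) (Hdeg F n t) (cartanH F n) where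
  closed := by
    rw [H_eq_map]
    exact PoissonClosed.map fun f _ g _ => poisson_mem_topFree f g
  closed_zero := by
    rw [Hdeg_eq_map (k := 2) rfl]
    exact PoissonClosed.map fun f hf g hg => poisson_mem_homog (k := 1) (l := 1) hf hg
  neg_le := Hdeg_le_H le_rfl (by omega)
  zero_le := Hdeg_le_H (by omega) (by omega)
  top_le := Hdeg_le_H ht htn
  cartan_le := cartanH_le_Hdeg_zero

theorem fpd_sub_fpd_prime_mem_cartanH (i : Fin n) :
    fpd F (xi F i) i - fpd F (xi F (prime i)) (prime i) ∈ cartanH F n := by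
  by_cases hi : i.val < n / 2
  · exact Submodule.subset_span ⟨i, hi, rfl⟩
  by_cases hi' : i.val < 2 * (n / 2)
  · rw [← neg_sub]
    refine neg_mem (Submodule.subset_span ⟨prime i, ?_, by rw [prime_prime]⟩)
    rw [prime_val, if_neg hi, if_pos hi']
    omega
  · have : prime i = i := Fin.ext (by rw [prime_val, if_neg hi, if_neg hi'])
    rw [this, sub_self]
    exact zero_mem _

theorem diag_mem_cartanH [NeZero (2 : F)] {c : Fin n → F} (hc : ∀ i, c (prime i) = -c i) :
    diag c ∈ cartanH F n := by
  have sum_prime_eq : ∑ i, c i • fpd F (xi F (prime i)) (prime i) = -diag c := by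
    rw [← sum_prime, diag_apply, ← Finset.sum_neg_distrib]
    exact Finset.sum_congr rfl fun i _ => by rw [prime_prime, hc, neg_smul_end]
  have two_smul_diag : (2 : F) • diag c =
      ∑ i, c i • (fpd F (xi F i) i - fpd F (xi F (prime i)) (prime i)) := by
    simp only [smul_sub, Finset.sum_sub_distrib, sum_prime_eq, two_smul, sub_neg_eq_add,
      ← diag_apply]
  rw [← Submodule.smul_mem_iff _ (two_ne_zero (α := F)), two_smul_diag]
  exact Submodule.sum_mem _ fun i _ => Submodule.smul_mem _ _ (fpd_sub_fpd_prime_mem_cartanH i)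

theorem coordOn_prime (i : Fin n) (h : cartanH F n) :
    coordOn (cartanH F n) (prime i) h = -coordOn (cartanH F n) i h := by
  have : cartanH F n ≤ LinearMap.ker (coord (F := F) (prime i) + coord i) := by
    refine Submodule.span_le.2 ?_
    rintro _ ⟨k, -, rfl⟩
    simp only [SetLike.mem_coe, LinearMap.mem_ker, LinearMap.add_apply, map_sub, coord_fpd_xi,
      prime_eq_iff, prime_prime]
    ring
  exact eq_neg_of_add_eq_zero_left (this h.2)

theorem diag_pd (c : Fin n → F) (k : Fin n) (g : Grassmann F n) :
    diag c (pd F k g) = pd F k (diag c g) - c k • pd F k g := by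
  simp only [diag_apply, LinearMap.sum_apply, LinearMap.smul_apply, fpd_apply, map_sum, map_smul,
    pd_xi_mul, smul_sub, Finset.sum_sub_distrib, smul_ite, smul_zero, Finset.sum_ite_eq,
    Finset.mem_univ, if_true, pd_pd k, mul_neg, smul_neg, Finset.sum_neg_distrib]
  abel

variable [NeZero (2 : F)]

theorem superBracket_diag_ham {c : Fin n → F} (hc : ∀ i, c (prime i) = -c i)
    (g : Grassmann F n) : superBracket (diag c) (ham g) = ham (diag c g) := by
  rw [ham_apply, ham_apply, superBracket_sum_right]
  refine Finset.sum_congr rfl fun k _ => ?_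
  rw [superBracket_diag_fpd, diag_pd, hc, fpd_sub, fpd_smul, neg_smul_end]
  abel

theorem isWeightVector_ham_mono {V : Submodule F (Module.End F (Grassmann F n))}
    {u : Finset (Fin n)} (hu : u.Nonempty) (hV : ham (mono F u) ∈ V) :
    IsWeightVector (cartanH F n) V (∑ i ∈ u, coordOn (cartanH F n) i) (ham (mono F u)) := by
  refine ⟨hV, ham_mono_ne_zero hu, fun h => ?_⟩
  conv_lhs => rw [← diag_coordOn cartanH_le_cartanW h]
  rw [superBracket_diag_ham fun i => coordOn_prime i h, diag_mono, map_smul, LinearMap.sum_apply]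

end CartanH

section Separation

variable {n : ℕ}

/-- The diagonal entries of an element of the Cartan subalgebra of `H(n)` separating the weights
used for `H(n)`: up to sign the first entry is `10n`, far from the others, which lie between `n` and
`3n/2`. -/
def hamDiag (i : Fin n) : ℤ :=
  if i.val < n / 2 then (if i.val = 0 then 10 * n else n + i.val)
  else if i.val < 2 * (n / 2) then
    (if i.val = n / 2 then -(10 * n) else -(n + (i.val - n / 2)))
  else 0

theorem hamDiag_prime (i : Fin n) : hamDiag (prime i) = -hamDiag i := by
  have := i.2
  simp only [hamDiag, prime_val]
  split_ifs <;> omega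

theorem hamDiag_injective : Function.Injective (hamDiag (n := n)) := by
  intro i j h
  have := i.2
  have := j.2
  refine Fin.ext ?_
  simp only [hamDiag] at h
  split_ifs at h <;> omega

variable {F : Type*} [Field F] [NeZero (2 : F)]

theorem diag_hamDiag_mem_cartanH : diag (fun i => (hamDiag i : F)) ∈ cartanH F n :=
  diag_mem_cartanH fun i => by rw [hamDiag_prime, Int.cast_neg]

theorem sum_coordOn_hamDiag (u : Finset (Fin n)) :
    (∑ i ∈ u, coordOn (cartanH F n) i) ⟨diag fun i => (hamDiag i : F), diag_hamDiag_mem_cartanH⟩ =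
      ((∑ i ∈ u, hamDiag i : ℤ) : F) := by
  rw [LinearMap.sum_apply, Int.cast_sum]
  exact Finset.sum_congr rfl fun i _ => coord_diag _ _

end Separation

section HamiltonianGeneration

variable {F : Type*} [Field F] {n : ℕ} {V : Submodule F (Grassmann F n)}

theorem xi_mul_xi_mul_xi_rotate (a b c : Fin n) :
    xi F a * (xi F b * xi F c) = xi F b * (xi F c * xi F a) := by
  rw [← mul_assoc, xi_mul_xi a b, neg_mul, mul_assoc, xi_mul_xi a c, mul_neg, neg_neg]

theorem xi_mul_xi_mul_xi_swap (a b c : Fin n) :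
    xi F a * (xi F b * xi F c) = -(xi F b * (xi F a * xi F c)) := by
  rw [← mul_assoc, xi_mul_xi a b, neg_mul, mul_assoc]

theorem xi_mul_xi_mul_xi_mem_of_mono_mem {a b c : Fin n} (h : mono F {a, b, c} ∈ V) :
    xi F a * (xi F b * xi F c) ∈ V := by
  have := prodXi_mem_of_mono_mem (V := V) (l := [a, b, c]) fun _ => by simpa using h
  simpa [prodXi] using this

theorem xi_mul_xi_mem_of_mono_mem {a b : Fin n} (h : mono F {a, b} ∈ V) :
    xi F a * xi F b ∈ V := by
  have := prodXi_mem_of_mono_mem (V := V) (l := [a, b]) fun _ => by simpa using h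
  simpa [prodXi] using this

theorem homog_three_le
    (h : ∀ a b c, a ≠ b → a ≠ c → b ≠ c → xi F a * (xi F b * xi F c) ∈ V) : homog F n 3 ≤ V :=
  homog_le fun u hu => by
    obtain ⟨a, b, c, hab, hac, hbc, rfl⟩ := Finset.card_eq_three.1 hu
    exact mono_mem_of_prodXi_mem (l := [a, b, c]) (by simp [hab, hac, hbc]) (by simp)
      (by simpa [prodXi] using h a b c hab hac hbc)

theorem homog_one_le (h : ∀ a, xi F a ∈ V) : homog F n 1 ≤ V :=
  homog_le fun u hu => by
    obtain ⟨a, rfl⟩ := Finset.card_eq_one.1 hu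
    simpa using h a

theorem poisson_xi_mul_xi (p q : Fin n) (g : Grassmann F n) :
    poisson (xi F p * xi F q) g = xi F q * pd F (prime p) g - xi F p * pd F (prime q) g := by
  simp only [poisson, parity_mul, parity_xi, neg_mul_neg, pd_xi_mul, pd_xi, sub_mul, ite_mul,
    zero_mul, mul_ite, mul_one, mul_zero, Finset.sum_sub_distrib, Finset.sum_ite_eq',
    Finset.mem_univ, if_true]

theorem poisson_xi_mul_xi_mul_xi (a b c : Fin n) (g : Grassmann F n) :
    poisson (xi F a * (xi F b * xi F c)) g =
      -(xi F b * xi F c * pd F (prime a) g) + xi F a * xi F c * pd F (prime b) g -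
        xi F a * xi F b * pd F (prime c) g := by
  have summand : ∀ i, pd F i (parity F n (xi F a * (xi F b * xi F c))) * pd F (prime i) g =
      -(if i = a then xi F b * xi F c * pd F (prime i) g else 0) +
        (if i = b then xi F a * xi F c * pd F (prime i) g else 0) -
        (if i = c then xi F a * xi F b * pd F (prime i) g else 0) := by
    intro i
    simp only [parity_mul, parity_xi, neg_mul, map_neg, pd_xi_mul, pd_xi]
    split_ifs <;> noncomm_ring
  simp only [poisson, summand, Finset.sum_add_distrib, Finset.sum_sub_distrib,
    Finset.sum_neg_distrib, Finset.sum_ite_eq', Finset.mem_univ, if_true]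

theorem poisson_xi_mul_xi_mul_xi_prime {a b e : Fin n} {f : Grassmann F n} (hae : prime a ≠ e)
    (hbe : prime b ≠ e) (hef : pd F e f = 0)
    (ha : xi F (prime e) * (xi F e * pd F (prime a) f) = 0)
    (hb : xi F (prime e) * (xi F e * pd F (prime b) f) = 0) :
    poisson (xi F a * (xi F b * xi F (prime e))) (xi F e * f) = -(xi F a * (xi F b * f)) := by
  rw [poisson_xi_mul_xi_mul_xi, prime_prime]
  simp only [pd_xi_mul, if_neg hae, if_neg hbe, if_true, hef, zero_sub, mul_zero, sub_zero,
    mul_neg, mul_assoc, ha, hb, neg_zero, add_zero]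

theorem mono_mem_of_poisson (hV : PoissonClosed V) (h3 : homog F n 3 ≤ V) {k : ℕ}
    (hk : homog F n k ≤ V) {u : Finset (Fin n)} (hu : u.card = k + 1) {a b e : Fin n} (ha : a ∈ u)
    (hb : b ∈ u) (hab : a ≠ b) (he : e ∉ u) (hae : prime a ≠ e) (hbe : prime b ≠ e)
    (ha₀ : xi F (prime e) * (xi F e * pd F (prime a) (mono F ((u.erase a).erase b))) = 0)
    (hb₀ : xi F (prime e) * (xi F e * pd F (prime b) (mono F ((u.erase a).erase b))) = 0) :
    mono F u ∈ V := by
  set v := (u.erase a).erase b with v_def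
  have hb' : b ∈ u.erase a := Finset.mem_erase.2 ⟨hab.symm, hb⟩
  have card_v : 1 + v.card = k := by
    have := Finset.card_erase_add_one ha
    have := Finset.card_erase_add_one hb'
    rw [v_def]
    omega
  have hev : e ∉ v := fun h => he (Finset.mem_of_mem_erase (Finset.mem_of_mem_erase h))
  have cubic_mem : xi F a * (xi F b * xi F (prime e)) ∈ homog F n 3 := by
    simpa [prodXi] using prodXi_mem_homog (F := F) [a, b, prime e]
  have xi_mul_mono_mem : xi F e * mono F v ∈ homog F n k := by
    have := mul_mem_homog (xi_mem_homog (F := F) e) (mono_mem_homog (F := F) (u := v) rfl)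
    rwa [card_v] at this
  have := hV _ (h3 cubic_mem) _ (hk xi_mul_mono_mem)
  rw [poisson_xi_mul_xi_mul_xi_prime hae hbe (pd_mono_of_notMem hev) ha₀ hb₀, neg_mem_iff] at this
  rcases mono_eq_xi_mul (F := F) ha with h | h <;> rcases mono_eq_xi_mul (F := F) hb' with h' | h'
    <;> rw [h, h'] <;> simpa using this

theorem mono_mem_of_prime_mem_or_eq (hV : PoissonClosed V) (h3 : homog F n 3 ≤ V) {k : ℕ}
    (hk : homog F n k ≤ V) {u : Finset (Fin n)} (hu : u.card = k + 1) (hk2 : 2 ≤ k) {e : Fin n}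
    (he : e ∉ u) (he' : prime e ∈ u ∨ prime e = e) : mono F u ∈ V := by
  have one_lt : 1 < (u.erase (prime e)).card := by
    have := Finset.pred_card_le_card_erase (s := u) (a := prime e)
    omega
  obtain ⟨a, ha, b, hb, hab⟩ := Finset.one_lt_card.1 one_lt
  rw [Finset.mem_erase] at ha hb
  have mul_pd_eq_zero : ∀ c, c ∈ u → xi F (prime e) *
      (xi F e * pd F (prime c) (mono F ((u.erase a).erase b))) = 0 := by
    intro c hc
    rcases he' with he' | he'
    · have he'_mem : prime e ∈ (u.erase a).erase b :=
        Finset.mem_erase.2 ⟨hb.1.symm, Finset.mem_erase.2 ⟨ha.1.symm, he'⟩⟩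
      have hec : prime e ≠ prime c := prime_injective.ne fun h => he (h ▸ hc)
      rw [← mul_assoc, xi_mul_xi, neg_mul, mul_assoc, xi_mul_pd_mono_of_ne hec he'_mem, mul_zero,
        neg_zero]
    · rw [he', ← mul_assoc, xi_mul_self, zero_mul]
  exact mono_mem_of_poisson hV h3 hk hu ha.2 hb.2 hab he (fun h => ha.1 (prime_eq_iff.1 h))
    (fun h => hb.1 (prime_eq_iff.1 h)) (mul_pd_eq_zero a ha.2) (mul_pd_eq_zero b hb.2)

theorem mono_mem_of_prime_notMem (hV : PoissonClosed V) (h3 : homog F n 3 ≤ V) {k : ℕ}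
    (hk : homog F n k ≤ V) {u : Finset (Fin n)} (hu : u.card = k + 1) {a e : Fin n} (he : e ∉ u)
    (ha : a ∈ u) (ha' : prime a ∈ u) (hne : prime a ≠ a) : mono F u ∈ V := by
  refine mono_mem_of_poisson hV h3 hk hu ha ha' hne.symm he (fun h => he (h ▸ ha'))
    (fun h => he (by rwa [← h, prime_prime])) ?_ ?_
  · rw [pd_mono_of_notMem (by simp), mul_zero, mul_zero]
  · rw [prime_prime, pd_mono_of_notMem (by simp), mul_zero, mul_zero]

theorem exists_prime_ne_of_one_lt_card {u : Finset (Fin n)} (hu : 1 < u.card) :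
    ∃ a ∈ u, prime a ≠ a := by
  by_contra! h
  obtain ⟨a, ha, b, hb, hab⟩ := Finset.one_lt_card.1 hu
  have val_a := congrArg Fin.val (h a ha)
  have val_b := congrArg Fin.val (h b hb)
  have := a.2
  have := b.2
  rw [prime_val] at val_a val_b
  refine hab (Fin.ext ?_)
  split_ifs at val_a val_b <;> omega

theorem homog_succ_le (hV : PoissonClosed V) (h3 : homog F n 3 ≤ V) {k : ℕ}
    (hk : homog F n k ≤ V) (hk2 : 2 ≤ k) (hkn : k + 1 < n) : homog F n (k + 1) ≤ V := by
  refine homog_le fun u hu => ?_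
  by_cases hex : ∃ e, e ∉ u ∧ (prime e ∈ u ∨ prime e = e)
  · obtain ⟨e, he, he'⟩ := hex
    exact mono_mem_of_prime_mem_or_eq hV h3 hk hu hk2 he he'
  · push Not at hex
    obtain ⟨e, he⟩ : ∃ e, e ∉ u := by
      by_contra! h
      rw [Finset.eq_univ_of_forall h, Finset.card_univ, Fintype.card_fin] at hu
      omega
    obtain ⟨a, ha, hne⟩ := exists_prime_ne_of_one_lt_card (u := u) (by omega)
    have ha' : prime a ∈ u := by
      by_contra h
      exact (hex _ h).1 (by rwa [prime_prime])
    exact mono_mem_of_prime_notMem hV h3 hk hu he ha ha' hne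

theorem topFree_le (hV : PoissonClosed V) (h0 : 1 ∈ V) (h1 : homog F n 1 ≤ V)
    (h2 : homog F n 2 ≤ V) (h3 : homog F n 3 ≤ V) : topFree F n ≤ V := by
  have homog_le_of_two_le : ∀ k, 2 ≤ k → k < n → homog F n k ≤ V := fun k hk => by
    induction k, hk using Nat.le_induction with
    | base => exact fun _ => h2
    | succ k hk ih => exact fun hkn => homog_succ_le hV h3 (ih (by omega)) hk hkn
  refine Submodule.span_le.2 ?_
  rintro _ ⟨u, hu, rfl⟩
  have card_lt := (Finset.card_lt_iff_ne_univ u).2 hu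
  rw [Fintype.card_fin] at card_lt
  rcases hk : u.card with _ | _ | k
  · rwa [Finset.card_eq_zero.1 hk, mono_empty]
  · exact h1 (mono_mem_homog hk)
  · exact homog_le_of_two_le _ (by omega) (by omega) (mono_mem_homog hk)

theorem H_le_of_homog_le [NeZero (2 : F)] {N : Submodule F (Module.End F (Grassmann F n))}
    (hN : BracketClosed N) (h1 : homog F n 1 ≤ N.comap ham) (h2 : homog F n 2 ≤ N.comap ham)
    (h3 : homog F n 3 ≤ N.comap ham) : H F n ≤ N := by
  rw [H_eq_map, Submodule.map_le_iff_le_comap]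
  exact topFree_le hN.comap (by simp) h1 h2 h3

end HamiltonianGeneration

section OddHamiltonian

variable {F : Type*} [Field F] {n : ℕ} {V : Submodule F (Grassmann F n)} {z : Fin n}

theorem prime_ne_of_ne_fixed (hz : prime z = z) {a : Fin n} (ha : a ≠ z) : prime a ≠ z :=
  prime_eq_iff.not.2 (by rwa [hz])

theorem homog_two_le_of_fixed (hV : PoissonClosed V) (hz : prime z = z)
    (h : ∀ i, i ≠ z → xi F i * xi F z ∈ V) : homog F n 2 ≤ V := by
  refine homog_two_le fun i j hij => ?_
  by_cases hi : i = z
  · rw [hi, xi_mul_xi]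
    exact neg_mem (h j fun hj => hij (hi.trans hj.symm))
  by_cases hj : j = z
  · exact hj ▸ h i hi
  have bracket_mem := hV _ (h i hi) _ (h j hj)
  rw [poisson_xi_mul_xi, hz, pd_xi_mul, pd_xi_mul, pd_xi, pd_xi,
    if_neg (prime_ne_of_ne_fixed hz hi), if_neg (Ne.symm hj), if_pos rfl, mul_zero, sub_zero,
    zero_sub, mul_one, mul_neg, sub_neg_eq_add] at bracket_mem
  split_ifs at bracket_mem <;> simpa [xi_mul_self] using bracket_mem

theorem xi_mem_of_ne_prime (hV : PoissonClosed V) (h2 : homog F n 2 ≤ V) {a b : Fin n}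
    (ha : xi F a ∈ V) (hb : b ≠ prime a) : xi F b ∈ V := by
  have := hV _ (h2 (xi_mul_xi_mem_homog (prime a) b)) _ ha
  rw [poisson_xi_mul_xi, prime_prime, pd_xi, pd_xi, if_pos rfl, if_neg (prime_eq_iff.not.2 hb)]
    at this
  simpa using this

theorem homog_one_le_of_xi_mem (hV : PoissonClosed V) (hn : 2 < n) (h2 : homog F n 2 ≤ V)
    (h : xi F z ∈ V) : homog F n 1 ≤ V := by
  refine homog_one_le fun c => ?_
  by_cases hc : c = prime z
  · obtain ⟨i, hi, hi'⟩ := Fin.exists_ne_and_ne_of_two_lt z (prime z) hn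
    have xi_i_mem := xi_mem_of_ne_prime hV h2 h hi'
    exact xi_mem_of_ne_prime hV h2 xi_i_mem fun h => hi (prime_injective (h.symm.trans hc))
  · exact xi_mem_of_ne_prime hV h2 h hc

theorem cubic_mem_of_fixed (hV : PoissonClosed V) (hz : prime z = z) (h2 : homog F n 2 ≤ V)
    {a b c : Fin n} (ha : a ≠ z) (hb : b ≠ z) (hc : c ≠ z)
    (h : xi F a * (xi F b * xi F z) ∈ V) : xi F a * (xi F b * xi F c) ∈ V := by
  have bracket_mem := hV _ (h2 (xi_mul_xi_mem_homog c z)) _ h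
  have xi_mul_pd_eq_zero : xi F z * pd F (prime c) (xi F a * (xi F b * xi F z)) = 0 := by
    have xi_mul_cubic : ∀ x, xi F z * (xi F x * xi F z) = 0 := fun x => by
      rw [xi_mul_xi_mul_xi_rotate, xi_mul_self, mul_zero]
    rw [pd_xi_mul, pd_xi_mul, pd_xi, if_neg (prime_ne_of_ne_fixed hz hc), mul_zero, sub_zero]
    split_ifs <;> simp [mul_sub, xi_mul_cubic]
  rw [poisson_xi_mul_xi, xi_mul_pd_eq_zero, hz, pd_xi_mul, pd_xi_mul, pd_xi, if_neg ha.symm,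
    if_neg hb.symm, if_pos rfl, mul_one] at bracket_mem
  rw [← xi_mul_xi_mul_xi_rotate]
  simpa using bracket_mem

theorem cubic_swap_mem {a b c : Fin n} (h : xi F a * (xi F b * xi F c) ∈ V) :
    xi F b * (xi F a * xi F c) ∈ V := by
  rw [xi_mul_xi_mul_xi_swap]
  exact neg_mem h

theorem cubic_mem_replace_of_fixed (hV : PoissonClosed V) (hz : prime z = z)
    (h2 : homog F n 2 ≤ V) {a b c : Fin n} (ha : a ≠ z) (hb : b ≠ z) (hc : c ≠ z) (hab : a ≠ b)
    (h : xi F a * (xi F b * xi F z) ∈ V) : xi F c * (xi F b * xi F z) ∈ V := by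
  by_cases hac : a = c
  · exact hac ▸ h
  have cubic_mem := cubic_mem_of_fixed hV hz h2 ha hb hc h
  have bracket_mem := hV _ (h2 (xi_mul_xi_mem_homog (prime a) z)) _ cubic_mem
  rw [poisson_xi_mul_xi, prime_prime, hz, pd_xi_mul, pd_xi_mul, pd_xi, pd_xi_mul, pd_xi_mul, pd_xi,
    if_neg ha.symm, if_neg hb.symm, if_neg hc.symm, if_pos rfl, if_neg hab, if_neg hac]
    at bracket_mem
  refine cubic_swap_mem ?_
  rw [← xi_mul_xi_mul_xi_rotate]
  simpa using bracket_mem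

theorem cubic_mem_of_ne_fixed (hV : PoissonClosed V) (hz : prime z = z) (h2 : homog F n 2 ≤ V)
    {i j : Fin n} (hi : i ≠ z) (hj : j ≠ z) (hij : i ≠ j) (h : xi F i * (xi F j * xi F z) ∈ V)
    {a b : Fin n} (ha : a ≠ z) (hb : b ≠ z) : xi F a * (xi F b * xi F z) ∈ V := by
  have replace_j : ∀ c, c ≠ z → xi F c * (xi F i * xi F z) ∈ V := fun c hc =>
    cubic_mem_replace_of_fixed hV hz h2 hj hi hc hij.symm (cubic_swap_mem h)
  by_cases hbi : b = i
  · exact hbi ▸ replace_j a ha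
  · exact cubic_mem_replace_of_fixed hV hz h2 hi hb ha (Ne.symm hbi)
      (cubic_swap_mem (replace_j b hb))

theorem homog_three_le_of_fixed (hV : PoissonClosed V) (hz : prime z = z) (h2 : homog F n 2 ≤ V)
    {i j : Fin n} (hi : i ≠ z) (hj : j ≠ z) (hij : i ≠ j)
    (h : xi F i * (xi F j * xi F z) ∈ V) : homog F n 3 ≤ V := by
  have cubic_mem : ∀ a b, a ≠ z → b ≠ z → xi F a * (xi F b * xi F z) ∈ V := fun _ _ =>
    cubic_mem_of_ne_fixed hV hz h2 hi hj hij h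
  refine homog_three_le fun a b c hab hac hbc => ?_
  by_cases ha : a = z
  · subst ha
    rw [xi_mul_xi_mul_xi_rotate]
    exact cubic_mem b c hab.symm hac.symm
  by_cases hb : b = z
  · subst hb
    rw [← xi_mul_xi_mul_xi_rotate]
    exact cubic_mem c a hbc.symm hab
  by_cases hc : c = z
  · exact hc ▸ cubic_mem a b ha hb
  · exact cubic_mem_of_fixed hV hz h2 ha hb hc (cubic_mem a b ha hb)

end OddHamiltonian

section EvenHamiltonian

variable {F : Type*} [Field F] {n : ℕ} {V : Submodule F (Grassmann F n)}

theorem xi_mul_xi_add_mem_of_cross (hV : PoissonClosed V) {z : Fin n}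
    (h : ∀ e j, e = z ∨ e = prime z → j ≠ z → j ≠ prime z → xi F e * xi F j ∈ V) {i j : Fin n}
    (hi : i ≠ z) (hi' : i ≠ prime z) (hj : j ≠ z) (hj' : j ≠ prime z) :
    xi F i * xi F j + (if prime i = j then xi F z * xi F (prime z) else 0) ∈ V := by
  have := hV _ (h z i (Or.inl rfl) hi hi') _ (h (prime z) j (Or.inr rfl) hj hj')
  rw [poisson_xi_mul_xi, pd_xi_mul, pd_xi_mul, pd_xi, pd_xi, if_pos rfl, if_neg hj'.symm,
    if_neg (prime_injective.ne hi)] at this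
  split_ifs at this ⊢ <;> simpa using this

theorem xi_mul_xi_prime_mem_of_cross [NeZero (2 : F)] (hV : PoissonClosed V) (hn : 2 < n)
    {z : Fin n}
    (h : ∀ e j, e = z ∨ e = prime z → j ≠ z → j ≠ prime z → xi F e * xi F j ∈ V) :
    xi F z * xi F (prime z) ∈ V := by
  obtain ⟨i, hi, hi'⟩ := Fin.exists_ne_and_ne_of_two_lt z (prime z) hn
  have hpi : prime i ≠ z := prime_eq_iff.not.2 hi'
  have add_mem_i := xi_mul_xi_add_mem_of_cross hV h hi hi' hpi (prime_injective.ne hi)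
  have add_mem_prime_i := xi_mul_xi_add_mem_of_cross hV h hpi (prime_injective.ne hi) hi hi'
  rw [if_pos rfl] at add_mem_i
  rw [prime_prime, if_pos rfl, xi_mul_xi] at add_mem_prime_i
  have two_smul_eq : xi F i * xi F (prime i) + xi F z * xi F (prime z) +
      (-(xi F i * xi F (prime i)) + xi F z * xi F (prime z)) =
      (2 : F) • (xi F z * xi F (prime z)) := by
    rw [two_smul]
    abel
  exact (Submodule.smul_mem_iff _ two_ne_zero).1 (two_smul_eq ▸ add_mem add_mem_i add_mem_prime_i)

theorem homog_two_le_of_cross [NeZero (2 : F)] (hV : PoissonClosed V) (hn : 2 < n) {z : Fin n}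
    (h : ∀ e j, e = z ∨ e = prime z → j ≠ z → j ≠ prime z → xi F e * xi F j ∈ V) :
    homog F n 2 ≤ V := by
  have mem_z := xi_mul_xi_prime_mem_of_cross hV hn h
  have mem_left : ∀ e j, e = z ∨ e = prime z → e ≠ j → xi F e * xi F j ∈ V := by
    intro e j he hej
    by_cases hj : j = z
    · subst hj
      rw [he.resolve_left hej, xi_mul_xi]
      exact neg_mem mem_z
    by_cases hj' : j = prime z
    · subst hj'
      rwa [he.resolve_right hej]
    exact h e j he hj hj'
  refine homog_two_le fun i j hij => ?_
  by_cases hi : i = z ∨ i = prime z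
  · exact mem_left i j hi hij
  by_cases hj : j = z ∨ j = prime z
  · rw [xi_mul_xi]
    exact neg_mem (mem_left j i hj hij.symm)
  push Not at hi hj
  have mem_add := xi_mul_xi_add_mem_of_cross hV h hi.1 hi.2 hj.1 hj.2
  split_ifs at mem_add
  · exact (Submodule.add_mem_iff_left _ mem_z).1 mem_add
  · simpa using mem_add

theorem cubic_prime_mem_replace (hV : PoissonClosed V) (h2 : homog F n 2 ≤ V) {a b q : Fin n}
    (hab : a ≠ b) (hab' : a ≠ prime b) (hqa' : q ≠ prime a) (hqb : q ≠ b) (hqb' : q ≠ prime b)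
    (h : xi F a * (xi F b * xi F (prime b)) ∈ V) : xi F q * (xi F b * xi F (prime b)) ∈ V := by
  have bracket_mem := hV _ (h2 (xi_mul_xi_mem_homog (prime a) q)) _ h
  rw [poisson_xi_mul_xi, prime_prime, pd_xi_mul, pd_xi_mul, pd_xi, pd_xi_mul, pd_xi_mul, pd_xi,
    if_pos rfl, if_neg hab, if_neg hab', if_neg (prime_eq_iff.not.2 hqa'),
    if_neg (prime_eq_iff.not.2 hqb'), if_neg (prime_injective.ne hqb)] at bracket_mem
  simpa using bracket_mem

theorem cubic_mem_of_cubic_prime_mem (hV : PoissonClosed V) (h2 : homog F n 2 ≤ V)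
    {a b q : Fin n} (hb : prime b ≠ b) (hab' : a ≠ prime b) (hqa' : q ≠ prime a)
    (hqb' : q ≠ prime b) (h : xi F a * (xi F b * xi F (prime b)) ∈ V) :
    xi F a * (xi F b * xi F q) ∈ V := by
  have bracket_mem := hV _ (h2 (xi_mul_xi_mem_homog b q)) _ h
  rw [poisson_xi_mul_xi, pd_xi_mul, pd_xi_mul, pd_xi, pd_xi_mul, pd_xi_mul, pd_xi, if_pos rfl,
    if_neg hab'.symm, if_neg hb, if_neg (prime_eq_iff.not.2 hqa'),
    if_neg (prime_eq_iff.not.2 hqb')] at bracket_mem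
  have xi_mul_cubic : xi F b * (xi F a * xi F b) = 0 := by
    rw [xi_mul_xi_mul_xi_rotate, xi_mul_self, mul_zero]
  have rotate := xi_mul_xi_mul_xi_rotate (F := F) q a b
  split_ifs at bracket_mem <;> simpa [xi_mul_cubic, rotate] using bracket_mem

theorem cubic_prime_mem_shift (hV : PoissonClosed V) (h2 : homog F n 2 ≤ V) {a b q : Fin n}
    (hb : prime b ≠ b) (hab : a ≠ b) (hab' : a ≠ prime b) (hqa : q ≠ a) (hqa' : q ≠ prime a)
    (hqb : q ≠ b) (hqb' : q ≠ prime b) (h : xi F a * (xi F b * xi F (prime b)) ∈ V) :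
    xi F a * (xi F q * xi F (prime q)) ∈ V := by
  have cubic_mem := cubic_mem_of_cubic_prime_mem hV h2 hb hab' hqa' hqb' h
  have bracket_mem := hV _ (h2 (xi_mul_xi_mem_homog (prime b) (prime q))) _ cubic_mem
  rw [poisson_xi_mul_xi, prime_prime, prime_prime, pd_xi_mul, pd_xi_mul, pd_xi, pd_xi_mul,
    pd_xi_mul, pd_xi, if_neg hab.symm, if_pos rfl, if_neg hqb.symm, if_neg hqa, if_neg hqb,
    if_pos rfl] at bracket_mem
  simp only [zero_sub, sub_zero, mul_zero, mul_one, mul_neg, sub_neg_eq_add,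
    zero_add] at bracket_mem
  rw [xi_mul_xi_mul_xi_rotate (prime q) a q, xi_mul_xi_mul_xi_rotate (prime b) a b] at bracket_mem
  exact neg_mem_iff.1 ((Submodule.sub_mem_iff_left _ h).1 bracket_mem)

theorem exists_ne_of_four_lt (hn : 4 < n) (a b c d : Fin n) :
    ∃ x, x ≠ a ∧ x ≠ b ∧ x ≠ c ∧ x ≠ d := by
  obtain ⟨x, -, hx⟩ := Finset.exists_mem_notMem_of_card_lt_card
    (s := ({a, b, c, d} : Finset (Fin n))) (t := Finset.univ)
    (Finset.card_le_four.trans_lt (by simpa using hn))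
  exact ⟨x, by simpa using hx⟩

theorem cubic_prime_mem_of_ne (hV : PoissonClosed V) (hn : 4 < n) (h2 : homog F n 2 ≤ V)
    {a b x : Fin n} (hab : a ≠ b) (hab' : a ≠ prime b) (hx : x ≠ b) (hx' : x ≠ prime b)
    (h : xi F a * (xi F b * xi F (prime b)) ∈ V) : xi F x * (xi F b * xi F (prime b)) ∈ V := by
  by_cases hxa : x = prime a
  · obtain ⟨q, hqa, hqa', hqb, hqb'⟩ := exists_ne_of_four_lt hn a (prime a) b (prime b)
    exact cubic_prime_mem_replace hV h2 hqb hqb' (hxa ▸ prime_injective.ne hqa.symm) hx hx'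
      (cubic_prime_mem_replace hV h2 hab hab' hqa' hqb hqb' h)
  · exact cubic_prime_mem_replace hV h2 hab hab' hxa hx hx' h

theorem cubic_prime_mem (hV : PoissonClosed V) (hn : 4 < n) (h2 : homog F n 2 ≤ V) {i j : Fin n}
    (hj : prime j ≠ j) (hij : i ≠ j) (hij' : i ≠ prime j)
    (h : xi F i * (xi F j * xi F (prime j)) ∈ V) {b x : Fin n} (hx : x ≠ b)
    (hx' : x ≠ prime b) : xi F x * (xi F b * xi F (prime b)) ∈ V := by
  by_cases hbj : b = j
  · subst hbj
    exact cubic_prime_mem_of_ne hV hn h2 hij hij' hx hx' h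
  by_cases hbj' : b = prime j
  · subst hbj'
    rw [prime_prime] at hx' ⊢
    rw [xi_mul_xi, mul_neg]
    exact neg_mem (cubic_prime_mem_of_ne hV hn h2 hij hij' hx' hx h)
  · obtain ⟨q, hqj, hqj', hqb, hqb'⟩ := exists_ne_of_four_lt hn j (prime j) b (prime b)
    have cubic_q_mem := cubic_prime_mem_of_ne hV hn h2 hij hij' hqj hqj' h
    have cubic_q_prime_mem := cubic_prime_mem_shift hV h2 hj hqj hqj' hqb.symm
      (fun h => hqb' (prime_eq_iff.1 h.symm)) hbj hbj' cubic_q_mem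
    exact cubic_prime_mem_of_ne hV hn h2 hqb hqb' hx hx' cubic_q_prime_mem

theorem homog_three_le_of_forall_prime_ne (hV : PoissonClosed V) (hn : 4 < n)
    (hp : ∀ i : Fin n, prime i ≠ i) (h2 : homog F n 2 ≤ V) {i j : Fin n} (hij : i ≠ j)
    (hij' : i ≠ prime j) (h : xi F i * (xi F j * xi F (prime j)) ∈ V) : homog F n 3 ≤ V := by
  have mem_prime : ∀ b x, x ≠ b → x ≠ prime b → xi F x * (xi F b * xi F (prime b)) ∈ V :=
    fun _ _ => cubic_prime_mem hV hn h2 (hp j) hij hij' h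
  refine homog_three_le fun a b c hab hac hbc => ?_
  by_cases hab' : a = prime b
  · subst hab'
    rw [xi_mul_xi_mul_xi_swap, ← xi_mul_xi_mul_xi_rotate c b (prime b)]
    exact neg_mem (mem_prime b c hbc.symm hac.symm)
  by_cases hca' : c = prime a
  · subst hca'
    exact cubic_swap_mem (mem_prime a b hab.symm hbc)
  by_cases hcb' : c = prime b
  · subst hcb'
    exact mem_prime b a hab hab'
  · exact cubic_mem_of_cubic_prime_mem hV h2 (hp b) hab' hca' hcb' (mem_prime b a hab hab')

end EvenHamiltonian

section HamiltonianGenerators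

theorem hamDiag_le {n : ℕ} (k : Fin n) : hamDiag k ≤ 10 * n := by
  have := k.2
  simp only [hamDiag]
  split_ifs <;> omega

variable {F : Type*} [Field F] [CharZero F] {n : ℕ}

theorem hasCartanGenerators_H_of_monomials (hn : 4 ≤ n) {r : ℕ} {κ : Type*} [Finite κ]
    {U : κ → Finset (Fin n)} {z : Fin n} {T : Fin r → Finset (Fin n)} (hU : ∀ k, (U k).card = 2)
    (hT : ∀ s, (T s).card = 3)
    (hwt : Function.Injective (Sum.elim (fun k => ∑ i ∈ U k, hamDiag i)
      (Sum.elim (fun _ : Unit => hamDiag z) fun s => ∑ i ∈ T s, hamDiag i)))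
    (gen₀ : ∀ V : Submodule F (Grassmann F n), PoissonClosed V → (∀ k, mono F (U k) ∈ V) →
      homog F n 2 ≤ V)
    (gen : ∀ V : Submodule F (Grassmann F n), PoissonClosed V → homog F n 2 ≤ V →
      (∀ s, mono F (T s) ∈ V) → homog F n 3 ≤ V) :
    HasCartanGenerators r (H F n) (Hdeg F n (-1)) (Hdeg F n 0) (Hdeg F n 1) (cartanH F n) := by
  have isWeightVector (u : Finset (Fin n)) {d : ℤ} (hd : (u.card : ℤ) = d + 2) (hpos : 0 < u.card) :
      IsWeightVector (cartanH F n) (Hdeg F n d) (∑ i ∈ u, coordOn (cartanH F n) i)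
        (ham (mono F u)) :=
    isWeightVector_ham_mono (Finset.card_pos.1 hpos) (ham_mono_mem_Hdeg hd)
  refine hasCartanGenerators_of (cartanData_H F n (by omega) (by omega) (by omega))
    (isWeightVector {z} (by simp) (by simp))
    (fun k => isWeightVector (U k) (by simp [hU k]) (by simp [hU k]))
    (fun s => isWeightVector (T s) (by simp [hT s]) (by simp [hT s]))
    (injective_of_apply_eq_intCast (V := cartanH F n) (x := ⟨_, diag_hamDiag_mem_cartanH⟩)
      ?_ hwt) ∅ (fun _ _ N hN _ hU_mem => ?_) fun N hN h₀ hz hT_mem => ?_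
  · rintro (k | _ | s)
    · exact sum_coordOn_hamDiag _
    · simpa using sum_coordOn_hamDiag {z}
    · exact sum_coordOn_hamDiag _
  · rw [Hdeg_eq_map (k := 2) rfl, Submodule.map_le_iff_le_comap]
    exact gen₀ _ hN.comap hU_mem
  · rw [Hdeg_eq_map (k := 2) rfl, Submodule.map_le_iff_le_comap] at h₀
    refine H_le_of_homog_le hN (homog_one_le_of_xi_mem hN.comap (by omega) h₀ (z := z) ?_)
      h₀ (gen _ hN.comap h₀ hT_mem)
    simpa using hz

variable (F) in
theorem hasCartanGenerators_H_odd (hn : 5 ≤ n) (hodd : n % 2 = 1) :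
    HasCartanGenerators 1 (H F n) (Hdeg F n (-1)) (Hdeg F n 0) (Hdeg F n 1) (cartanH F n) := by
  obtain ⟨z, hz⟩ : ∃ z : Fin n, z.val = n - 1 := ⟨⟨n - 1, by omega⟩, rfl⟩
  obtain ⟨i, hi⟩ : ∃ i : Fin n, i.val = 0 := ⟨⟨0, by omega⟩, rfl⟩
  obtain ⟨j, hj⟩ : ∃ j : Fin n, j.val = 1 := ⟨⟨1, by omega⟩, rfl⟩
  have prime_z : prime z = z := Fin.ext (by rw [prime_val, if_neg, if_neg] <;> omega)
  have hij : i ≠ j := fun h => by rw [h] at hi; omega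
  have hiz : i ≠ z := fun h => by rw [h] at hi; omega
  have hjz : j ≠ z := fun h => by rw [h] at hj; omega
  have hamDiag_z : hamDiag z = 0 := by grind [hamDiag]
  have hamDiag_i : hamDiag i = 10 * n := by grind [hamDiag]
  have hamDiag_j : hamDiag j = n + 1 := by grind [hamDiag]
  have sum_pair (k : {k // k ≠ z}) : ∑ i ∈ {k.1, z}, hamDiag i = hamDiag k.1 := by
    rw [Finset.sum_pair k.2, hamDiag_z, add_zero]
  have sum_triple : ∑ i ∈ {i, j, z}, hamDiag i = 11 * n + 1 := by
    rw [Finset.sum_insert (by simp [hij, hiz]), Finset.sum_pair hjz, hamDiag_i, hamDiag_j,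
      hamDiag_z]
    ring
  refine hasCartanGenerators_H_of_monomials (by omega) (U := fun k : {k // k ≠ z} => {k.1, z})
    (z := z) (T := fun _ => {i, j, z}) (fun k => Finset.card_pair k.2)
    (fun _ => Finset.card_eq_three.2 ⟨i, j, z, hij, hiz, hjz, rfl⟩) ?_
    (fun V hV hU_mem => homog_two_le_of_fixed hV prime_z fun k hk =>
      xi_mul_xi_mem_of_mono_mem (hU_mem ⟨k, hk⟩))
    fun V hV h2 hT_mem => homog_three_le_of_fixed hV prime_z h2 hiz hjz hij
      (xi_mul_xi_mul_xi_mem_of_mono_mem (hT_mem 0))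
  simp only [sum_pair, sum_triple, hamDiag_z]
  refine (hamDiag_injective.comp Subtype.val_injective).sumElim
    ((Function.injective_of_subsingleton _).sumElim (Function.injective_of_subsingleton _) ?_) ?_
  · intro _ _
    omega
  · rintro k (_ | _)
    · exact hamDiag_z ▸ hamDiag_injective.ne k.2
    · have := hamDiag_le k.1
      simp only [Function.comp_apply, Sum.elim_inr]
      omega

end HamiltonianGenerators

section EvenWeights

variable {n : ℕ} {z i j : Fin n}

theorem prime_ne_self (heven : n % 2 = 0) (k : Fin n) : prime k ≠ k := fun h => by
  have val_eq := congrArg Fin.val h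
  have := k.2
  rw [prime_val] at val_eq
  split_ifs at val_eq <;> omega

/-- A pair `(e, k)` of indices with `e ∈ {z, z'}` and `k ∉ {z, z'}`. The elements `ham (ξ_e ξ_k)` of
these pairs are root vectors which generate the degree-zero part of `H(n)` for even `n`. -/
abbrev CrossPair (z : Fin n) : Type :=
  {p : Fin n × Fin n // (p.1 = z ∨ p.1 = prime z) ∧ p.2 ≠ z ∧ p.2 ≠ prime z}

theorem CrossPair.fst_ne_snd (p : CrossPair z) : p.1.1 ≠ p.1.2 := fun h =>
  p.2.1.elim (fun hz => p.2.2.1 (h.symm.trans hz)) fun hz => p.2.2.2 (h.symm.trans hz)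

theorem CrossPair.hamDiag_fst (hz : z.val = 0) (hn : 2 ≤ n) (p : CrossPair z) :
    hamDiag p.1.1 = 10 * n ∨ hamDiag p.1.1 = -(10 * n) := by
  have hamDiag_z : hamDiag z = 10 * n := by grind [hamDiag]
  rcases p.2.1 with h | h
  · exact .inl (by rw [h, hamDiag_z])
  · exact .inr (by rw [h, hamDiag_prime, hamDiag_z])

theorem CrossPair.hamDiag_snd (hz : z.val = 0) (heven : n % 2 = 0) (p : CrossPair z) :
    (n < hamDiag p.1.2 ∧ 2 * hamDiag p.1.2 < 3 * n) ∨
      (hamDiag p.1.2 < -n ∧ -(3 * n) < 2 * hamDiag p.1.2) := by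
  obtain ⟨⟨e, k⟩, -, hkz, hkz'⟩ := p
  have := k.2
  have val_ne_zero : k.val ≠ 0 := fun h => hkz (Fin.ext (h.trans hz.symm))
  have val_ne_half : k.val ≠ n / 2 := fun h => hkz' (Fin.ext (by
    rw [prime_val, hz, if_pos (by omega), h, zero_add]))
  simp only [hamDiag]
  split_ifs <;> omega

theorem CrossPair.hamDiag_add_injective (hz : z.val = 0) (hn : 2 ≤ n) (heven : n % 2 = 0) :
    Function.Injective fun p : CrossPair z => hamDiag p.1.1 + hamDiag p.1.2 := by
  intro p q h
  beta_reduce at h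
  have fst_p := p.hamDiag_fst hz hn
  have fst_q := q.hamDiag_fst hz hn
  have snd_p := p.hamDiag_snd hz heven
  have snd_q := q.hamDiag_snd hz heven
  have fst_eq : hamDiag p.1.1 = hamDiag q.1.1 := by omega
  have snd_eq : hamDiag p.1.2 = hamDiag q.1.2 := by omega
  exact Subtype.ext (Prod.ext (hamDiag_injective fst_eq) (hamDiag_injective snd_eq))

/-- The index sets of the (at most two) weight vectors used in `H(n)_1` for even `n`. The first
alone generates `H(n)` together with degrees `-1` and `0`. -/
def evenTop (z i j : Fin n) (s : ℕ) : Finset (Fin n) :=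
  if s = 0 then {i, j, prime j} else {z, i, j}

theorem card_evenTop (hp : prime j ≠ j) (hzi : z ≠ i) (hzj : z ≠ j) (hij : i ≠ j)
    (hij' : i ≠ prime j) (s : ℕ) : (evenTop z i j s).card = 3 := by
  unfold evenTop
  split_ifs
  · exact Finset.card_eq_three.2 ⟨i, j, prime j, hij, hij', hp.symm, rfl⟩
  · exact Finset.card_eq_three.2 ⟨z, i, j, hzi, hzj, hij, rfl⟩

theorem sum_hamDiag_evenTop (hp : prime j ≠ j) (hzi : z ≠ i) (hzj : z ≠ j) (hij : i ≠ j)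
    (hij' : i ≠ prime j) (s : ℕ) :
    ∑ k ∈ evenTop z i j s, hamDiag k =
      if s = 0 then hamDiag i else hamDiag z + hamDiag i + hamDiag j := by
  unfold evenTop
  split_ifs
  · rw [Finset.sum_insert (by simp [hij, hij']), Finset.sum_pair hp.symm, hamDiag_prime]
    ring
  · rw [Finset.sum_insert (by simp [hzi, hzj]), Finset.sum_pair hij, add_assoc]

end EvenWeights

theorem hasCartanGenerators_H_even (F : Type*) [Field F] [CharZero F] {n r : ℕ} (hr : 0 < r)
    (hr2 : r ≤ 2) (hn : 5 ≤ n) (heven : n % 2 = 0) :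
    HasCartanGenerators r (H F n) (Hdeg F n (-1)) (Hdeg F n 0) (Hdeg F n 1) (cartanH F n) := by
  obtain ⟨z, hz⟩ : ∃ z : Fin n, z.val = 0 := ⟨⟨0, by omega⟩, rfl⟩
  obtain ⟨i, hi⟩ : ∃ i : Fin n, i.val = 1 := ⟨⟨1, by omega⟩, rfl⟩
  obtain ⟨j, hj⟩ : ∃ j : Fin n, j.val = 2 := ⟨⟨2, by omega⟩, rfl⟩
  have hp := prime_ne_self heven
  have hzi : z ≠ i := by grind
  have hzj : z ≠ j := by grind
  have hij : i ≠ j := by grind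
  have hij' : i ≠ prime j := fun h => by grind [prime_val j]
  have hamDiag_z : hamDiag z = 10 * n := by grind [hamDiag]
  have hamDiag_i : hamDiag i = n + 1 := by grind [hamDiag]
  have hamDiag_j : hamDiag j = n + 2 := by grind [hamDiag]
  refine hasCartanGenerators_H_of_monomials (by omega) (U := fun p : CrossPair z => {p.1.1, p.1.2})
    (z := z) (T := fun s : Fin r => evenTop z i j s) (fun p => Finset.card_pair p.fst_ne_snd)
    (fun s => card_evenTop (hp j) hzi hzj hij hij' s) ?_
    (fun V hV hU_mem => homog_two_le_of_cross hV (by omega) fun e k he hk hk' =>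
      xi_mul_xi_mem_of_mono_mem (hU_mem ⟨(e, k), he, hk, hk'⟩))
    fun V hV h2 hT_mem => homog_three_le_of_forall_prime_ne hV hn hp h2 hij hij'
      (xi_mul_xi_mul_xi_mem_of_mono_mem (by simpa [evenTop] using hT_mem ⟨0, hr⟩))
  simp only [Finset.sum_pair (CrossPair.fst_ne_snd _),
    sum_hamDiag_evenTop (hp j) hzi hzj hij hij', hamDiag_z, hamDiag_i, hamDiag_j]
  refine (CrossPair.hamDiag_add_injective hz (by omega) heven).sumElim
    ((Function.injective_of_subsingleton _).sumElim ?_ ?_) ?_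
  · intro s t h
    grind
  · intro _ s
    split_ifs <;> omega
  · rintro p (_ | s) <;> have := p.hamDiag_fst hz (by omega) <;> have := p.hamDiag_snd hz heven
    · simp only [Sum.elim_inl]
      omega
    · simp only [Sum.elim_inr]
      split_ifs <;> omega

theorem hasCartanGenerators_H (F : Type*) [Field F] [CharZero F] {n : ℕ} (hn : 5 ≤ n) :
    HasCartanGenerators (if n = 6 then 2 else 1) (H F n) (Hdeg F n (-1)) (Hdeg F n 0)
      (Hdeg F n 1) (cartanH F n) := by
  rcases Nat.mod_two_eq_zero_or_one n with heven | hodd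
  · exact hasCartanGenerators_H_even F (by split_ifs <;> omega) (by split_ifs <;> omega) hn heven
  · rw [if_neg (by omega)]
    exact hasCartanGenerators_H_odd F hn hodd

end CartanSuper

end

theorem mainTheorem3_general (F : Type*) [Field F] [CharZero F] :
    (∀ n : ℕ, 3 ≤ n → CartanSuper.HasCartanGenerators 1 (CartanSuper.W F n)
      (CartanSuper.Wdeg F n (-1)) (CartanSuper.Wdeg F n 0) (CartanSuper.Wdeg F n (n - 1))
      (CartanSuper.cartanW F n)) ∧
    (∀ n : ℕ, 4 ≤ n → CartanSuper.HasCartanGenerators 1 (CartanSuper.S F n)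
      (CartanSuper.Sdeg F n (-1)) (CartanSuper.Sdeg F n 0) (CartanSuper.Sdeg F n (n - 2))
      (CartanSuper.cartanS F n)) ∧
    (∀ m : ℕ, 2 ≤ m → CartanSuper.HasCartanGenerators 1 (CartanSuper.St F m)
      (CartanSuper.Stdeg F m (-1)) (CartanSuper.Stdeg F m 0) (CartanSuper.Stdeg F m 1)
      (CartanSuper.cartanS F (2 * m))) ∧
    (∀ n : ℕ, 5 ≤ n → CartanSuper.HasCartanGenerators (if n = 6 then 2 else 1)
      (CartanSuper.H F n) (CartanSuper.Hdeg F n (-1)) (CartanSuper.Hdeg F n 0)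
      (CartanSuper.Hdeg F n 1) (CartanSuper.cartanH F n)) :=
  ⟨fun _ hn => CartanSuper.hasCartanGenerators_W F hn,
    fun _ hn => CartanSuper.hasCartanGenerators_S F hn,
    fun _ hm => CartanSuper.hasCartanGenerators_St F hm,
    fun _ hn => CartanSuper.hasCartanGenerators_H F hn⟩

theorem mainTheorem3 (F : Type*) [Field F] [IsAlgClosed F] [CharZero F] :
    (∀ n : ℕ, 3 ≤ n → CartanSuper.HasCartanGenerators 1 (CartanSuper.W F n)
      (CartanSuper.Wdeg F n (-1)) (CartanSuper.Wdeg F n 0) (CartanSuper.Wdeg F n (n - 1))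
      (CartanSuper.cartanW F n)) ∧
    (∀ n : ℕ, 4 ≤ n → CartanSuper.HasCartanGenerators 1 (CartanSuper.S F n)
      (CartanSuper.Sdeg F n (-1)) (CartanSuper.Sdeg F n 0) (CartanSuper.Sdeg F n (n - 2))
      (CartanSuper.cartanS F n)) ∧
    (∀ m : ℕ, 2 ≤ m → CartanSuper.HasCartanGenerators 1 (CartanSuper.St F m)
      (CartanSuper.Stdeg F m (-1)) (CartanSuper.Stdeg F m 0) (CartanSuper.Stdeg F m 1)
      (CartanSuper.cartanS F (2 * m))) ∧
    (∀ n : ℕ, 5 ≤ n → CartanSuper.HasCartanGenerators (if n = 6 then 2 else 1)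
      (CartanSuper.H F n) (CartanSuper.Hdeg F n (-1)) (CartanSuper.Hdeg F n 0)
      (CartanSuper.Hdeg F n 1) (CartanSuper.cartanH F n)) :=
  mainTheorem3_general F
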